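/- Let $\mathrm{Sk}_4$ be the space of complex skew-symmetric $4\times4$ matrices $X=(x_{ij})$, with Pfaffian $\mathrm{Pf}(X)=x_{12}x_{34}-x_{13}x_{24}+x_{14}x_{23}$. Two holomorphic map germs $M_1,M_2:(\mathbb C^s,0)\to(\mathrm{Sk}_4,0)$ are called $\mathrm{Sk}$-equivalent if $M_1\circ\varphi=A^\top M_2A$ for some germ of biholomorphism $\varphi:(\mathbb C^s,0)\to(\mathbb C^s,0)$ and some holomorphic map germ $A$ from $(\mathbb C^s,0)$ to $\mathrm{GL}_4(\mathbb C)$; for each $k$ this induces an equivalence relation (division into orbits) on the space $J^k$ of $k$-jets at $0$ of germs $(\mathbb C^s,0)\to(\mathrm{Sk}_4,0)$. A germ $M:(\mathbb C^s,0)\to(\mathrm{Sk}_4,0)$ is called $\mathrm{Sk}_4$-simple if, for all sufficiently large $k$, some neighbourhood of the $k$-jet of $M$ in $J^k$ meets only finitely many orbits. Let $s\ge3$ and let $M:(\mathbb C^s,0)\to(\mathrm{Sk}_4,0)$ be a holomorphic map germ that is $\mathrm{Sk}_4$-simple. The $2$-jet $j^2_0(\mathrm{Pf}\circ M)$ is a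 quadratic form on $\mathbb C^s$ (because $M(0)=0$). Then: (i) the rank of $j^2_0(\mathrm{Pf}\circ M)$ is positive; (ii) if moreover $s\ge4$, the rank of $j^2_0(\mathrm{Pf}\circ M)$ is at least $2$. -/

import Mathlib

open Topology Filter

namespace SkFamilies

/-- (A representative of) a holomorphic map germ `M : (ℂˢ, 0) → (Sk_n, 0)` into the space of
skew-symmetric complex `n × n` matrices. As `M 0 = 0`, these are exactly the germs of families of
skew-symmetric `n × n` matrices whose matrix corank (the corank of `M 0`) is `n`.
Everything below depends only on the germ of `toFun` at `0`. -/
structure SkGerm (s n : ℕ) where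
  /-- the underlying matrix family; only its values near the origin matter -/
  toFun : (Fin s → ℂ) → Matrix (Fin n) (Fin n) ℂ
  analytic : ∀ a b, AnalyticAt ℂ (fun x => toFun x a b) 0
  skew : ∀ᶠ x in 𝓝 (0 : Fin s → ℂ), (toFun x).transpose = -toFun x
  map_zero : toFun 0 = 0

/-- `φ` is (a representative of) a germ of biholomorphism `(ℂˢ, 0) → (ℂˢ, 0)`. -/
def IsBiholoGerm {s : ℕ} (φ : (Fin s → ℂ) → (Fin s → ℂ)) : Prop :=
  AnalyticAt ℂ φ 0 ∧ φ 0 = 0 ∧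
    ∃ ψ : (Fin s → ℂ) → (Fin s → ℂ), AnalyticAt ℂ ψ 0 ∧ ψ 0 = 0 ∧
      (∀ᶠ x in 𝓝 (0 : Fin s → ℂ), ψ (φ x) = x) ∧ (∀ᶠ x in 𝓝 (0 : Fin s → ℂ), φ (ψ x) = x)

/-- `A` is (a representative of) a holomorphic map germ from `(ℂˢ, 0)` to `GL_n(ℂ)`. -/
def IsGLGerm {s n : ℕ} (A : (Fin s → ℂ) → Matrix (Fin n) (Fin n) ℂ) : Prop :=
  (∀ a b, AnalyticAt ℂ (fun x => A x a b) 0) ∧ ∀ᶠ x in 𝓝 (0 : Fin s → ℂ), IsUnit (A x)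

/-- `Sk`-equivalence of germs: `M₁ ∘ φ = Aᵀ M₂ A` near the origin. -/
def SkEquivalent {s n : ℕ} (M₁ M₂ : SkGerm s n) : Prop :=
  ∃ (φ : (Fin s → ℂ) → (Fin s → ℂ)) (A : (Fin s → ℂ) → Matrix (Fin n) (Fin n) ℂ),
    IsBiholoGerm φ ∧ IsGLGerm A ∧
      ∀ᶠ x in 𝓝 (0 : Fin s → ℂ), M₁.toFun (φ x) = (A x).transpose * M₂.toFun x * A x

/-- The finite-dimensional space in which `k`-jets at the origin of `n × n` matrix families are
recorded: for each order `i ≤ k` and each entry, a multilinear form of degree `i` on `ℂˢ`. -/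
abbrev JetSpace (s n k : ℕ) : Type :=
  (i : Fin (k + 1)) → Fin n → Fin n →
    ContinuousMultilinearMap ℂ (fun _ : Fin (i : ℕ) => (Fin s → ℂ)) ℂ

/-- The `k`-jet of `M` at the origin: all derivatives of order `≤ k` of all entries. -/
noncomputable def SkGerm.jet {s n : ℕ} (k : ℕ) (M : SkGerm s n) : JetSpace s n k :=
  fun i a b => iteratedFDeriv ℂ (i : ℕ) (fun x => M.toFun x a b) 0

/-- The `k`-jets of `M` and `N` lie in the same orbit of the group of (`k`-jets of)
`Sk`-equivalences acting on the space of `k`-jets: some germ `Sk`-equivalent to `M` has the same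
`k`-jet as `N`. -/
def JetEquivalent {s n : ℕ} (k : ℕ) (M N : SkGerm s n) : Prop :=
  ∃ N' : SkGerm s n, SkEquivalent M N' ∧ N'.jet k = N.jet k

/-- `M : (ℂˢ, 0) → (Sk_n, 0)` is `Sk_n`-simple, i.e. simple (of modality zero) among all germs of
the same matrix corank: for all sufficiently large `k`, a sufficiently small neighbourhood of the
`k`-jet of `M` in the space of `k`-jets of germs `(ℂˢ, 0) → (Sk_n, 0)` meets only finitely many
orbits of the `Sk`-equivalence group. -/
def IsSkSimple {s n : ℕ} (M : SkGerm s n) : Prop :=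
  ∀ᶠ k : ℕ in atTop, ∃ U ∈ 𝓝 (M.jet k), ∃ F : Set (SkGerm s n), F.Finite ∧
    ∀ M' : SkGerm s n, M'.jet k ∈ U → ∃ N ∈ F, JetEquivalent k M' N

/-- The Pfaffian of a skew-symmetric `4 × 4` matrix. -/
def pfaffian4 (X : Matrix (Fin 4) (Fin 4) ℂ) : ℂ :=
  X 0 1 * X 2 3 - X 0 2 * X 1 3 + X 0 3 * X 1 2

/-- The symmetric matrix of the quadratic part `∑ᵢⱼ Hᵢⱼ xᵢ xⱼ` of the Taylor expansion of `f` at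
the origin, `Hᵢⱼ = ½ ∂ᵢ∂ⱼ f (0)`. -/
noncomputable def quadraticPart {s : ℕ} (f : (Fin s → ℂ) → ℂ) : Matrix (Fin s) (Fin s) ℂ :=
  Matrix.of fun i j =>
    (1 / 2 : ℂ) * iteratedFDeriv ℂ 2 f 0 ![Pi.single i 1, Pi.single j 1]

/-- The rank of the `2`-jet at the origin of `Pf ∘ M`. Since `M 0 = 0`, the function `Pf ∘ M`
has zero value and zero differential at the origin, so its `2`-jet is a quadratic form, and this is
the rank of that form. -/
noncomputable def rankPfTwoJet {s : ℕ} (M : SkGerm s 4) : ℕ :=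
  (quadraticPart fun x => pfaffian4 (M.toFun x)).rank

end SkFamilies

/-! Suppose the conclusion fails. Then the radical `K` of the quadratic part of `Pf ∘ M` has
dimension `m ≥ 3` and codimension at most one.

Let `L` and `Q` be the linear and quadratic parts of `M`. The cubic part of `Pf ∘ M` is `⟨L x, Q(x,
x)⟩` for the polarised Pfaffian, so the 2-jet of `M` determines it. An equivalence multiplies `Pf ∘
M` by a unit and changes coordinates. The extra cubic terms this creates vanish on `K`, so the cubic
restricted to `K` is an invariant up to a linear change and a nonzero scalar
(`JetEquivalent.exists_linearEquiv`). A cube root absorbs the scalar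
(`JetEquivalent.exists_mulVec`).

It remains to see moduli among these cubics. Varying `Q` changes the cubic only within the ideal
generated by the components of `L` on `K`. A small perturbation makes `L` of rank at least two on
`K` without shrinking `K` (`exists_perturb_two_le_rank`). The ideal then contains two independent
linear forms `x₀`, `x₁`, and the cubics in `(x₀, x₁)` form a space of dimension exactly `m²`.

This equals the dimension of the space of `m × m` matrices, so a bare parameter count is not enough.
A marked zero decides: the forms `x₀`, `x₁` are chosen to vanish at a nonzero zero `v` of the cubic
(`exists_cubic_zero`), so the whole family vanishes at `v`. A matrix `G` taking a normal form `c` to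
a member of the family must satisfy `c (G v) = 0`, a null condition when `c ≠ 0`. The parameters are
a differentiable function of `G`, so finitely many normal forms reach only a null set of parameters,
never a neighbourhood (`not_covered_by_finite_cubics`). -/

namespace SkFamilies

/-! ### Second-order expansions of curves -/

section TwoJet

variable {E F : Type*} [NormedAddCommGroup E] [NormedSpace ℂ E]
  [NormedAddCommGroup F] [NormedSpace ℂ F]

/-- The curve `a` has the expansion `a t = t a₁ + t² a₂ + o(t²)` at the origin. -/
def HasTwoJet (a : ℂ → F) (a₁ a₂ : F) : Prop :=
  Tendsto (fun t : ℂ => (t ^ 2)⁻¹ • (a t - t • a₁)) (𝓝[≠] 0) (𝓝 a₂)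

theorem hasTwoJet_smul_const (x : F) : HasTwoJet (fun t : ℂ => t • x) x 0 := by
  simp [HasTwoJet]

theorem HasTwoJet.congr {a b : ℂ → F} {a₁ a₂ : F} (h : HasTwoJet a a₁ a₂)
    (hab : ∀ᶠ t in 𝓝[≠] 0, a t = b t) : HasTwoJet b a₁ a₂ := by
  refine Tendsto.congr' ?_ h
  filter_upwards [hab] with t ht
  rw [ht]

theorem tendsto_id_punctured : Tendsto (fun t : ℂ => t) (𝓝[≠] 0) (𝓝 0) :=
  tendsto_id.mono_left nhdsWithin_le_nhds

theorem HasTwoJet.tendsto_inv_smul {a : ℂ → F} {a₁ a₂ : F} (h : HasTwoJet a a₁ a₂) :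
    Tendsto (fun t : ℂ => t⁻¹ • a t) (𝓝[≠] 0) (𝓝 a₁) := by
  have h1 : Tendsto (fun t : ℂ => a₁ + t • (t ^ 2)⁻¹ • (a t - t • a₁)) (𝓝[≠] 0)
      (𝓝 (a₁ + (0 : ℂ) • a₂)) :=
    tendsto_const_nhds.add (tendsto_id_punctured.smul h)
  rw [zero_smul, add_zero] at h1
  refine h1.congr' ?_
  filter_upwards [self_mem_nhdsWithin] with t ht
  have ht : t ≠ 0 := ht
  rw [smul_smul, smul_sub, smul_smul]
  have e1 : t * (t ^ 2)⁻¹ = t⁻¹ := by field_simp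
  rw [e1, inv_mul_cancel₀ ht, one_smul]
  abel

theorem HasTwoJet.tendsto {a : ℂ → F} {a₁ a₂ : F} (h : HasTwoJet a a₁ a₂) :
    Tendsto a (𝓝[≠] 0) (𝓝 0) := by
  have h1 := tendsto_id_punctured.smul h.tendsto_inv_smul
  rw [zero_smul] at h1
  refine h1.congr' ?_
  filter_upwards [self_mem_nhdsWithin] with t ht
  have ht : t ≠ 0 := ht
  rw [smul_smul, mul_inv_cancel₀ ht, one_smul]

theorem HasTwoJet.unique {a : ℂ → F} {a₁ a₂ b₁ b₂ : F} (h : HasTwoJet a a₁ a₂)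
    (h' : HasTwoJet a b₁ b₂) : a₁ = b₁ ∧ a₂ = b₂ := by
  have e := tendsto_nhds_unique h.tendsto_inv_smul h'.tendsto_inv_smul
  subst e
  exact ⟨rfl, tendsto_nhds_unique h h'⟩

/-- Second order Taylor expansion of an analytic map. -/
theorem analyticAt_taylor_two [CompleteSpace F] {f : E → F} (hf : AnalyticAt ℂ f 0)
    (h0 : f 0 = 0) :
    (fun y => f y - (fderiv ℂ f 0 y + (1 / 2 : ℂ) • fderiv ℂ (fderiv ℂ f) 0 y y))
      =O[𝓝 0] fun y => ‖y‖ ^ 3 := by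
  obtain ⟨p, r, hp⟩ := hf
  have key := (HasFPowerSeriesOnBall.hasFPowerSeriesAt hp).isBigO_sub_partialSum_pow 3
  refine key.congr_left fun y => ?_
  have e0 := hp.factorial_smul y 0
  have e1 := hp.factorial_smul y 1
  have e2 := hp.factorial_smul y 2
  rw [iteratedFDeriv_one_apply] at e1
  rw [iteratedFDeriv_two_apply] at e2
  simp only [Nat.factorial, one_smul, iteratedFDeriv_zero_apply, h0, mul_one] at e0 e1 e2
  have e2' : p 2 (fun _ => y) = (1 / 2 : ℂ) • fderiv ℂ (fderiv ℂ f) 0 y y := by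
    rw [← e2, ← Nat.cast_smul_eq_nsmul ℂ, smul_smul]
    norm_num
  simp only [FormalMultilinearSeries.partialSum, Finset.sum_range_succ, Finset.sum_range_zero,
    zero_add, e2', e0]
  rw [← e1]
  simp

/-- The second-order chain rule. The second-order term of the curve enters only through the
derivative of `f`. -/
theorem HasTwoJet.comp_analyticAt [CompleteSpace F] {f : E → F} (hf : AnalyticAt ℂ f 0)
    (h0 : f 0 = 0) {γ : ℂ → E} {h p : E} (hγ : HasTwoJet γ h p) :
    HasTwoJet (fun t => f (γ t)) (fderiv ℂ f 0 h)
      (fderiv ℂ f 0 p + (1 / 2 : ℂ) • fderiv ℂ (fderiv ℂ f) 0 h h) := by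
  set D := fderiv ℂ f 0
  set D₂ := fderiv ℂ (fderiv ℂ f) 0
  have hT := (analyticAt_taylor_two hf h0).comp_tendsto hγ.tendsto
  have hO : γ =O[𝓝[≠] 0] fun t : ℂ => t := by
    have h2 := (hγ.tendsto_inv_smul.isBigO_one ℂ)
    have h3 := (Asymptotics.isBigO_refl (fun t : ℂ => t) (𝓝[≠] 0)).smul h2
    refine (h3.congr' ?_ ?_)
    · filter_upwards [self_mem_nhdsWithin] with t ht
      have ht : t ≠ 0 := ht
      rw [smul_smul, mul_inv_cancel₀ ht, one_smul]
    · simp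
  have hR : Tendsto (fun t : ℂ => (t ^ 2)⁻¹ •
      (f (γ t) - (D (γ t) + (1 / 2 : ℂ) • D₂ (γ t) (γ t)))) (𝓝[≠] 0) (𝓝 0) := by
    have h1 : (fun t : ℂ => f (γ t) - (D (γ t) + (1 / 2 : ℂ) • D₂ (γ t) (γ t)))
        =O[𝓝[≠] 0] fun t : ℂ => t ^ 3 := by
      refine hT.trans ?_
      exact (hO.norm_left.pow 3)
    have h2 := (Asymptotics.isBigO_refl (fun t : ℂ => (t ^ 2)⁻¹) (𝓝[≠] 0)).smul h1
    refine h2.trans_tendsto ?_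
    refine tendsto_id_punctured.congr' ?_
    filter_upwards [self_mem_nhdsWithin] with t ht
    have ht : t ≠ 0 := ht
    simp only [smul_eq_mul]
    field_simp
  have hD : Tendsto (fun t : ℂ => D ((t ^ 2)⁻¹ • (γ t - t • h))) (𝓝[≠] 0) (𝓝 (D p)) :=
    (D.continuous.tendsto p).comp hγ
  have hD₂ : Tendsto (fun t : ℂ => (1 / 2 : ℂ) • D₂ (t⁻¹ • γ t) (t⁻¹ • γ t)) (𝓝[≠] 0)
      (𝓝 ((1 / 2 : ℂ) • D₂ h h)) := by
    have hc : Continuous fun x : E => (1 / 2 : ℂ) • D₂ x x := by fun_prop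
    exact (hc.tendsto h).comp hγ.tendsto_inv_smul
  have hs := (hD.add hD₂).add hR
  rw [add_zero] at hs
  refine hs.congr' ?_
  filter_upwards [self_mem_nhdsWithin] with t ht
  have ht : t ≠ 0 := ht
  simp only [map_smul, map_sub, _root_.smul_apply, smul_sub, smul_add, smul_smul]
  have e : 1 / 2 * (t⁻¹ * t⁻¹) = (t ^ 2)⁻¹ * (1 / 2) := by field_simp
  rw [e]
  abel

theorem HasTwoJet.of_analyticAt [CompleteSpace F] {f : E → F} (hf : AnalyticAt ℂ f 0)
    (h0 : f 0 = 0) (x : E) :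
    HasTwoJet (fun t : ℂ => f (t • x)) (fderiv ℂ f 0 x)
      ((1 / 2 : ℂ) • fderiv ℂ (fderiv ℂ f) 0 x x) := by
  simpa using (hasTwoJet_smul_const x).comp_analyticAt hf h0

end TwoJet

/-! ### The Pfaffian as a nondegenerate quadratic form on `ℂ⁶` -/

section Pfaffian

/-- The entries above the diagonal of a `4 × 4` matrix. -/
def upperEntries (X : Matrix (Fin 4) (Fin 4) ℂ) : Fin 6 → ℂ :=
  ![X 0 1, X 0 2, X 0 3, X 1 2, X 1 3, X 2 3]

/-- The skew-symmetric matrix with given entries above the diagonal. -/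
def skewMatrix (a : Fin 6 → ℂ) : Matrix (Fin 4) (Fin 4) ℂ :=
  !![0, a 0, a 1, a 2; -a 0, 0, a 3, a 4; -a 1, -a 3, 0, a 5; -a 2, -a 4, -a 5, 0]

theorem transpose_skewMatrix (a : Fin 6 → ℂ) : (skewMatrix a).transpose = -skewMatrix a := by
  ext i j
  fin_cases i <;> fin_cases j <;> simp [skewMatrix]

theorem upperEntries_skewMatrix (a : Fin 6 → ℂ) : upperEntries (skewMatrix a) = a := by
  ext i
  fin_cases i <;> simp [skewMatrix, upperEntries]

theorem upperEntries_zero : upperEntries 0 = 0 := by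
  ext i
  fin_cases i <;> simp [upperEntries]

theorem skewMatrix_zero : skewMatrix 0 = 0 := by
  ext i j
  fin_cases i <;> fin_cases j <;> simp [skewMatrix]

theorem skewMatrix_upperEntries {X : Matrix (Fin 4) (Fin 4) ℂ} (hX : X.transpose = -X) :
    skewMatrix (upperEntries X) = X := by
  have h : ∀ i j, X j i = -X i j := fun i j => congrFun (congrFun hX i) j
  have h0 : ∀ i, X i i = 0 := fun i => self_eq_neg.mp (h i i)
  ext i j
  fin_cases i <;> fin_cases j <;> simp [skewMatrix, upperEntries, h0] <;>
    exact (h _ _).symm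

/-- The Pfaffian in terms of the entries above the diagonal. -/
def pf (a : Fin 6 → ℂ) : ℂ := a 0 * a 5 - a 1 * a 4 + a 2 * a 3

/-- The polar bilinear form of the Pfaffian. -/
def pfPolar : (Fin 6 → ℂ) →ₗ[ℂ] (Fin 6 → ℂ) →ₗ[ℂ] ℂ :=
  LinearMap.mk₂ ℂ
    (fun a b => a 0 * b 5 + a 5 * b 0 - a 1 * b 4 - a 4 * b 1 + a 2 * b 3 + a 3 * b 2)
    (by intros; simp only [Pi.add_apply]; ring)
    (by intros; simp only [Pi.smul_apply, smul_eq_mul]; ring)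
    (by intros; simp only [Pi.add_apply]; ring)
    (by intros; simp only [Pi.smul_apply, smul_eq_mul]; ring)

theorem pfPolar_apply (a b : Fin 6 → ℂ) :
    pfPolar a b = a 0 * b 5 + a 5 * b 0 - a 1 * b 4 - a 4 * b 1 + a 2 * b 3 + a 3 * b 2 := rfl

theorem pfPolar_comm (a b : Fin 6 → ℂ) : pfPolar a b = pfPolar b a := by
  simp only [pfPolar_apply]; ring

theorem pf_add (a b : Fin 6 → ℂ) : pf (a + b) = pf a + pfPolar a b + pf b := by
  simp only [pf, pfPolar_apply, Pi.add_apply]; ring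

theorem pf_smul (t : ℂ) (a : Fin 6 → ℂ) : pf (t • a) = t ^ 2 * pf a := by
  simp only [pf, Pi.smul_apply, smul_eq_mul]; ring

theorem pfPolar_self (a : Fin 6 → ℂ) : pfPolar a a = 2 * pf a := by
  simp only [pf, pfPolar_apply]; ring

/-- Nondegeneracy: the polar form pairs each coordinate with its complementary one, up to sign, so
the representing vector can be read off. -/
theorem exists_pfPolar_eq (f : Module.Dual ℂ (Fin 6 → ℂ)) : ∃ w, ∀ a, pfPolar a w = f a := by
  refine ⟨![f (Pi.single 5 1), -f (Pi.single 4 1), f (Pi.single 3 1), f (Pi.single 2 1),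
    -f (Pi.single 1 1), f (Pi.single 0 1)], fun a => ?_⟩
  have h : f a = ∑ i, a i * f (Pi.single i 1) := by
    conv_lhs => rw [pi_eq_sum_univ' a]
    simp
  rw [h, Fin.sum_univ_six, pfPolar_apply]
  simp
  ring

theorem continuous_pf : Continuous pf := by
  unfold pf; fun_prop

theorem continuous_pfPolar_left (a : Fin 6 → ℂ) : Continuous fun b => pfPolar a b := by
  simp only [pfPolar_apply]; fun_prop

theorem pf_upperEntries (X : Matrix (Fin 4) (Fin 4) ℂ) : pf (upperEntries X) = pfaffian4 X := by
  simp [pf, upperEntries, pfaffian4]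

theorem pfaffian4_congr (A : Matrix (Fin 4) (Fin 4) ℂ) (a : Fin 6 → ℂ) :
    pfaffian4 (A.transpose * skewMatrix a * A) = A.det * pf a := by
  simp only [pfaffian4, Matrix.mul_apply, Fin.sum_univ_four, Matrix.transpose_apply, skewMatrix,
    Matrix.det_succ_row_zero, pf]
  simp [Fin.sum_univ_succ, Fin.succAbove]
  ring

end Pfaffian

/-! ### Linear, quadratic and cubic data of a germ -/

section Germ

variable {s : ℕ}

namespace SkGerm

/-- The entries above the diagonal of a germ of skew-symmetric `4 × 4` matrices. -/
def coords (M : SkGerm s 4) (x : Fin s → ℂ) : Fin 6 → ℂ := upperEntries (M.toFun x)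

theorem analyticAt_coords (M : SkGerm s 4) : AnalyticAt ℂ M.coords 0 := by
  rw [show M.coords = fun x i => M.coords x i from rfl, analyticAt_pi_iff]
  intro i
  fin_cases i <;> exact M.analytic _ _

theorem coords_zero (M : SkGerm s 4) : M.coords 0 = 0 := by
  rw [coords, M.map_zero, upperEntries_zero]

/-- The linear part of a germ. -/
noncomputable def lin (M : SkGerm s 4) : (Fin s → ℂ) →L[ℂ] (Fin 6 → ℂ) := fderiv ℂ M.coords 0

/-- The quadratic part of a germ, as a bilinear map. -/
noncomputable def quad (M : SkGerm s 4) :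
    (Fin s → ℂ) →L[ℂ] (Fin s → ℂ) →L[ℂ] (Fin 6 → ℂ) :=
  (1 / 2 : ℂ) • fderiv ℂ (fderiv ℂ M.coords) 0

/-- The cubic part of the Pfaffian of a germ. -/
noncomputable def cubic (M : SkGerm s 4) (x : Fin s → ℂ) : ℂ := pfPolar (M.lin x) (M.quad x x)

/-- The radical of the quadratic part of the Pfaffian of a germ. -/
noncomputable def pfKernel (M : SkGerm s 4) : Submodule ℂ (Fin s → ℂ) :=
  LinearMap.ker (pfPolar.compl₁₂ M.lin.toLinearMap M.lin.toLinearMap)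

theorem mem_pfKernel {M : SkGerm s 4} {x : Fin s → ℂ} :
    x ∈ M.pfKernel ↔ ∀ y, pfPolar (M.lin x) (M.lin y) = 0 := by
  rw [pfKernel, LinearMap.mem_ker, LinearMap.ext_iff]
  rfl

theorem hasTwoJet_coords (M : SkGerm s 4) (x : Fin s → ℂ) :
    HasTwoJet (fun t : ℂ => M.coords (t • x)) (M.lin x) (M.quad x x) :=
  HasTwoJet.of_analyticAt M.analyticAt_coords M.coords_zero x

/-- Expansions along lines are unique, so 2-jets can be compared one entry and one direction at a
time. -/
theorem two_jet_eq_of_hasTwoJet {M N : SkGerm s 4}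
    (h : ∀ x i, ∃ a₁ a₂, HasTwoJet (fun t : ℂ => M.coords (t • x) i) a₁ a₂ ∧
      HasTwoJet (fun t : ℂ => N.coords (t • x) i) a₁ a₂) (x : Fin s → ℂ) :
    M.lin x = N.lin x ∧ M.quad x x = N.quad x x := by
  have hp : ∀ (M : SkGerm s 4) i, HasTwoJet (fun t : ℂ => M.coords (t • x) i) (M.lin x i)
      (M.quad x x i) := fun M i => by
    have := (tendsto_pi_nhds.mp (M.hasTwoJet_coords x)) i
    simpa [HasTwoJet] using this
  constructor <;> ext i <;> obtain ⟨a₁, a₂, h1, h2⟩ := h x i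
  · exact ((hp M i).unique h1).1.trans (h2.unique (hp N i)).1
  · exact ((hp M i).unique h1).2.trans (h2.unique (hp N i)).2

theorem two_jet_eq_of_jet_eq {M N : SkGerm s 4} {k : ℕ} (hk : 2 ≤ k) (h : M.jet k = N.jet k)
    (x : Fin s → ℂ) : M.lin x = N.lin x ∧ M.quad x x = N.quad x x := by
  refine two_jet_eq_of_hasTwoJet (fun x i => ?_) x
  have key : ∀ a b : Fin 4, ∃ a₁ a₂, HasTwoJet (fun t : ℂ => M.toFun (t • x) a b) a₁ a₂ ∧
      HasTwoJet (fun t : ℂ => N.toFun (t • x) a b) a₁ a₂ := by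
    intro a b
    have h1 := congrFun (congrFun (congrFun h ⟨1, by omega⟩) a) b
    have h2 := congrFun (congrFun (congrFun h ⟨2, by omega⟩) a) b
    have h1' := congrArg (fun T => T fun _ => x) h1
    have h2' := congrArg (fun T => T fun _ => x) h2
    simp only [jet] at h1' h2'
    have e1 : ∀ f : (Fin s → ℂ) → ℂ,
      iteratedFDeriv ℂ 1 f 0 (fun _ => x) = fderiv ℂ f 0 x := fun f => iteratedFDeriv_one_apply _
    have e2 : ∀ f : (Fin s → ℂ) → ℂ,
      iteratedFDeriv ℂ 2 f 0 (fun _ => x) = fderiv ℂ (fderiv ℂ f) 0 x x :=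
      fun f => iteratedFDeriv_two_apply _ _ _
    rw [e1, e1] at h1'
    rw [e2, e2] at h2'
    refine ⟨_, _, HasTwoJet.of_analyticAt (M.analytic a b) (by rw [M.map_zero]; rfl) x, ?_⟩
    rw [h1', h2']
    exact HasTwoJet.of_analyticAt (N.analytic a b) (by rw [N.map_zero]; rfl) x
  fin_cases i <;> exact key _ _

end SkGerm

/-- Comparison of the quadratic and cubic parts of two Pfaffians that differ by a unit along a
curve. -/
theorem pf_two_jet_compare {a b : ℂ → Fin 6 → ℂ} {D : ℂ → ℂ} {a₁ a₂ b₁ b₂ : Fin 6 → ℂ} {d d' : ℂ}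
    (ha : HasTwoJet a a₁ a₂) (hb : HasTwoJet b b₁ b₂)
    (hD : Tendsto (fun t : ℂ => t⁻¹ * (D t - d)) (𝓝[≠] 0) (𝓝 d'))
    (h : ∀ᶠ t in 𝓝[≠] 0, pf (a t) = D t * pf (b t)) :
    pf a₁ = d * pf b₁ ∧ pfPolar a₁ a₂ = d' * pf b₁ + d * pfPolar b₁ b₂ := by
  have hexp : ∀ (c : ℂ → Fin 6 → ℂ) (c₁ c₂ : Fin 6 → ℂ), HasTwoJet c c₁ c₂ →
      Tendsto (fun t : ℂ => (t ^ 2)⁻¹ * pf (c t)) (𝓝[≠] 0) (𝓝 (pf c₁)) ∧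
      Tendsto (fun t : ℂ => (t ^ 3)⁻¹ * (pf (c t) - t ^ 2 * pf c₁)) (𝓝[≠] 0)
        (𝓝 (pfPolar c₁ c₂)) := by
    intro c c₁ c₂ hc
    constructor
    · refine ((continuous_pf.tendsto _).comp hc.tendsto_inv_smul).congr fun t => ?_
      rw [Function.comp, pf_smul, inv_pow]
    · have h1 := ((continuous_pfPolar_left c₁).tendsto _).comp hc
      have h2 := tendsto_id_punctured.mul ((continuous_pf.tendsto _).comp hc)
      have h3 := h1.add h2
      rw [zero_mul, add_zero] at h3
      refine h3.congr' ?_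
      filter_upwards [self_mem_nhdsWithin] with t ht
      have ht : t ≠ 0 := ht
      -- With `c t = t c₁ + t² ρ` and `ρ → c₂`, one gets `pf (c t) = t² pf c₁ + t³ ⟨c₁, ρ⟩ + t⁴ pf
      -- ρ`.
      have e : c t = t • c₁ + t ^ 2 • ((t ^ 2)⁻¹ • (c t - t • c₁)) := by
        rw [smul_smul, mul_inv_cancel₀ (pow_ne_zero 2 ht), one_smul]; abel
      simp only [Function.comp]
      generalize (t ^ 2)⁻¹ • (c t - t • c₁) = ρ at e ⊢
      rw [e, pf_add, pf_smul, pf_smul]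
      simp only [map_smul, LinearMap.smul_apply, smul_eq_mul]
      field_simp
      ring
  obtain ⟨ha1, ha2⟩ := hexp a a₁ a₂ ha
  obtain ⟨hb1, hb2⟩ := hexp b b₁ b₂ hb
  have hDlim : Tendsto D (𝓝[≠] 0) (𝓝 d) := by
    have h1 := (tendsto_id_punctured.mul hD).add_const d
    rw [zero_mul, zero_add] at h1
    refine h1.congr' ?_
    filter_upwards [self_mem_nhdsWithin] with t ht
    have ht : t ≠ 0 := ht
    rw [mul_inv_cancel_left₀ ht]; ring
  have e1 : pf a₁ = d * pf b₁ := by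
    refine tendsto_nhds_unique ha1 ((hDlim.mul hb1).congr' ?_)
    filter_upwards [h] with t ht
    rw [ht]; ring
  refine ⟨e1, tendsto_nhds_unique ha2 (((hD.mul hb1).add (hb2.const_mul d)).congr' ?_)⟩
  filter_upwards [h, self_mem_nhdsWithin] with t ht ht0
  have ht0 : t ≠ 0 := ht0
  rw [ht, e1]
  field_simp
  ring

end Germ

/-! ### Invariance of the cubic on the radical -/

variable {s : ℕ}

/-- `Sk`-equivalence relates the Pfaffians by a unit and a change of coordinates. -/
theorem SkEquivalent.exists_pf_eq {M N : SkGerm s 4} (h : SkEquivalent M N) :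
    ∃ (ψ : (Fin s → ℂ) → (Fin s → ℂ)) (D : (Fin s → ℂ) → ℂ), AnalyticAt ℂ ψ 0 ∧ ψ 0 = 0 ∧
      Function.Bijective (fderiv ℂ ψ 0) ∧ DifferentiableAt ℂ D 0 ∧ D 0 ≠ 0 ∧
      ∀ᶠ y in 𝓝 0, pf (M.coords y) = D y * pf (N.coords (ψ y)) := by
  obtain ⟨φ, A, ⟨hφ, hφ0, ψ, hψ, hψ0, hψφ, hφψ⟩, ⟨hA, hAu⟩, hMN⟩ := h
  have hψt : Tendsto ψ (𝓝 0) (𝓝 0) := by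
    simpa [hψ0] using hψ.continuousAt.tendsto
  refine ⟨ψ, fun y => (A (ψ y)).det, hψ, hψ0, ?_, ?_, ?_, ?_⟩
  · have hφd : HasFDerivAt φ (fderiv ℂ φ 0) (ψ 0) := by
      rw [hψ0]; exact hφ.differentiableAt.hasFDerivAt
    have hψd : HasFDerivAt ψ (fderiv ℂ ψ 0) (φ 0) := by
      rw [hφ0]; exact hψ.differentiableAt.hasFDerivAt
    have c1 := hφd.comp 0 hψ.differentiableAt.hasFDerivAt
    have c2 := hψd.comp 0 hφ.differentiableAt.hasFDerivAt
    have e1 := c1.unique ((hasFDerivAt_id (𝕜 := ℂ) (0 : Fin s → ℂ)).congr_of_eventuallyEq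
      (hφψ.mono fun x hx => hx))
    have e2 := c2.unique ((hasFDerivAt_id (𝕜 := ℂ) (0 : Fin s → ℂ)).congr_of_eventuallyEq
      (hψφ.mono fun x hx => hx))
    refine Function.bijective_iff_has_inverse.mpr ⟨fderiv ℂ φ 0, fun x => ?_, fun x => ?_⟩
    · exact congrArg (fun T : (Fin s → ℂ) →L[ℂ] (Fin s → ℂ) => T x) e1
    · exact congrArg (fun T : (Fin s → ℂ) →L[ℂ] (Fin s → ℂ) => T x) e2
  · have hAd : ∀ a b, AnalyticAt ℂ (fun y => A (ψ y) a b) 0 := fun a b => by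
      have : AnalyticAt ℂ (fun x => A x a b) (ψ 0) := by rw [hψ0]; exact hA a b
      exact this.comp hψ
    simp only [Matrix.det_apply']
    exact (Finset.analyticAt_fun_sum _ fun σ _ => analyticAt_const.mul
      (Finset.analyticAt_fun_prod _ fun i _ => hAd _ _)).differentiableAt
  · have := hAu.self_of_nhds
    simpa [hψ0] using (Matrix.isUnit_iff_isUnit_det _).mp this
  · filter_upwards [hψt.eventually hMN, hφψ, hψt.eventually N.skew] with y hy hφy hs
    rw [SkGerm.coords, SkGerm.coords, pf_upperEntries]
    rw [hφy] at hy
    rw [hy, ← pfaffian4_congr, skewMatrix_upperEntries hs]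

/-- The radicals and the cubic parts of the Pfaffians of two germs with equivalent jets. -/
theorem JetEquivalent.exists_linearEquiv {M N : SkGerm s 4} {k : ℕ} (hk : 2 ≤ k)
    (h : JetEquivalent k M N) :
    ∃ (g : (Fin s → ℂ) ≃ₗ[ℂ] (Fin s → ℂ)) (d : ℂ), d ≠ 0 ∧
      (∀ x, x ∈ M.pfKernel ↔ g x ∈ N.pfKernel) ∧
      ∀ x ∈ M.pfKernel, M.cubic x = d * N.cubic (g x) := by
  obtain ⟨N', hMN, hj⟩ := h
  obtain ⟨ψ, D, hψ, hψ0, hbij, hD, hD0, hpf⟩ := hMN.exists_pf_eq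
  have hN : ∀ x, N'.lin x = N.lin x ∧ N'.quad x x = N.quad x x := SkGerm.two_jet_eq_of_jet_eq hk hj
  set g : (Fin s → ℂ) ≃ₗ[ℂ] (Fin s → ℂ) :=
    LinearEquiv.ofBijective (fderiv ℂ ψ 0).toLinearMap hbij with hg
  have hgx : ∀ x, fderiv ℂ ψ 0 x = g x := fun x => rfl
  -- Here `d'` comes from the derivative of the unit and `p` from the second-order part of the
  -- coordinate change. These are the two correction terms that have to vanish on the radical.
  have key : ∀ x, ∃ (d' : ℂ) (p : Fin s → ℂ),
      pf (M.lin x) = D 0 * pf (N.lin (g x)) ∧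
      M.cubic x = d' * pf (N.lin (g x)) +
        D 0 * (pfPolar (N.lin (g x)) (N.lin p) + N.cubic (g x)) := by
    intro x
    have h1 := HasTwoJet.of_analyticAt hψ hψ0 x
    rw [hgx] at h1
    generalize (1 / 2 : ℂ) • fderiv ℂ (fderiv ℂ ψ) 0 x x = p at h1
    have h2 := h1.comp_analyticAt N'.analyticAt_coords N'.coords_zero
    have hb : HasTwoJet (fun t : ℂ => N'.coords (ψ (t • x))) (N.lin (g x))
        (N.lin p + N.quad (g x) (g x)) := by
      rw [← (hN _).1, ← (hN p).1, ← (hN _).2]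
      exact h2
    have hline : HasDerivAt (fun t : ℂ => t • x) x 0 := by
      simpa using (hasDerivAt_id (0 : ℂ)).smul_const x
    have hDl : HasDerivAt (fun t : ℂ => D (t • x)) (fderiv ℂ D 0 x) 0 := by
      have : HasFDerivAt D (fderiv ℂ D 0) ((0 : ℂ) • x) := by
        rw [zero_smul]; exact hD.hasFDerivAt
      exact this.comp_hasDerivAt 0 hline
    have hDt := hasDerivAt_iff_tendsto_slope_zero.mp hDl
    simp only [zero_add, zero_smul, smul_eq_mul] at hDt
    have hev : ∀ᶠ t : ℂ in 𝓝[≠] 0,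
        pf (M.coords (t • x)) = D (t • x) * pf (N'.coords (ψ (t • x))) := by
      have ht : Tendsto (fun t : ℂ => t • x) (𝓝[≠] 0) (𝓝 0) := by
        simpa using hline.continuousAt.tendsto.mono_left (nhdsWithin_le_nhds (s := {0}ᶜ))
      exact ht.eventually hpf
    obtain ⟨e1, e2⟩ := pf_two_jet_compare (M.hasTwoJet_coords x) hb hDt hev
    refine ⟨fderiv ℂ D 0 x, p, e1, ?_⟩
    rw [SkGerm.cubic, e2, map_add]
    rfl
  -- Polarisation of the comparison of quadratic parts.
  have hpol : ∀ x y, pfPolar (M.lin x) (M.lin y) = D 0 * pfPolar (N.lin (g x)) (N.lin (g y)) := by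
    intro x y
    obtain ⟨-, -, hx, -⟩ := key x
    obtain ⟨-, -, hy, -⟩ := key y
    obtain ⟨-, -, hxy, -⟩ := key (x + y)
    simp only [map_add, pf_add] at hxy
    rw [hx, hy] at hxy
    linear_combination hxy
  refine ⟨g, D 0, hD0, fun x => ?_, fun x hx => ?_⟩
  · rw [SkGerm.mem_pfKernel, SkGerm.mem_pfKernel]
    constructor
    · intro h y
      have := h (g.symm y)
      rw [hpol, g.apply_symm_apply] at this
      exact (mul_eq_zero.mp this).resolve_left hD0
    · intro h y
      rw [hpol, h, mul_zero]
  · obtain ⟨d', p, h1, h2⟩ := key x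
    rw [SkGerm.mem_pfKernel] at hx
    have hz : pf (M.lin x) = 0 := by
      have := pfPolar_self (M.lin x)
      rw [hx] at this
      simpa using this.symm
    have hz' : pf (N.lin (g x)) = 0 := by
      rw [hz] at h1
      exact (mul_eq_zero.mp h1.symm).resolve_left hD0
    -- Since `x` lies in the radical, `g x` pairs to zero with every vector, in particular with `p`.
    have hp := hpol x (g.symm p)
    rw [hx, g.apply_symm_apply] at hp
    have hp' := (mul_eq_zero.mp hp.symm).resolve_left hD0
    rw [h2, hz', hp']
    ring

/-- The kernel of the matrix of the quadratic part of the Pfaffian. -/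
theorem rankPfTwoJet_add_finrank_pfKernel (M : SkGerm s 4) :
    rankPfTwoJet M + Module.finrank ℂ M.pfKernel = s := by
  set f : (Fin s → ℂ) → ℂ := fun x => pfaffian4 (M.toFun x) with hf
  have hfc : f = fun x => pf (M.coords x) := funext fun x => (pf_upperEntries _).symm
  have han : AnalyticAt ℂ f 0 := by
    have hc : ∀ i, AnalyticAt ℂ (fun x => M.coords x i) 0 :=
      analyticAt_pi_iff.mp M.analyticAt_coords
    rw [hfc]
    exact (((hc 0).mul (hc 5)).sub ((hc 1).mul (hc 4))).add ((hc 2).mul (hc 3))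
  have hf0 : f 0 = 0 := by simp [hfc, M.coords_zero, pf]
  have hq : ∀ x, (1 / 2 : ℂ) * fderiv ℂ (fderiv ℂ f) 0 x x = pf (M.lin x) := by
    intro x
    have h1 := HasTwoJet.of_analyticAt han hf0 x
    have h2 := (continuous_pf.tendsto _).comp (M.hasTwoJet_coords x).tendsto_inv_smul
    have h3 : HasTwoJet (fun t : ℂ => f (t • x)) 0 (pf (M.lin x)) := by
      refine h2.congr fun t => ?_
      simp only [Function.comp, hfc, pf_smul, smul_eq_mul, inv_pow, mul_zero, sub_zero]
    exact (h1.unique h3).2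
  have hsymm : ∀ x y, fderiv ℂ (fderiv ℂ f) 0 x y = fderiv ℂ (fderiv ℂ f) 0 y x := by
    intro x y
    have := (han.contDiffAt (n := 2)).isSymmSndFDerivAt (by simp)
    exact this.eq x y
  have hpol : ∀ x y, fderiv ℂ (fderiv ℂ f) 0 x y = pfPolar (M.lin x) (M.lin y) := by
    intro x y
    have := hq (x + y)
    simp only [map_add, pf_add, ← hq, _root_.add_apply] at this
    rw [hsymm y x] at this
    linear_combination this
  set H := quadraticPart f with hH
  have hH' : ∀ i j, H i j = (1 / 2 : ℂ) * pfPolar (M.lin (Pi.single i 1)) (M.lin (Pi.single j 1)) := by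
    intro i j
    rw [← hpol, hH, quadraticPart, Matrix.of_apply, iteratedFDeriv_two_apply]
    rfl
  have hmul : ∀ x i, H.mulVec x i = (1 / 2 : ℂ) * pfPolar (M.lin (Pi.single i 1)) (M.lin x) := by
    intro x i
    conv_rhs => rw [pi_eq_sum_univ' x]
    simp only [Matrix.mulVec, dotProduct, hH', map_sum, map_smul, smul_eq_mul, Finset.mul_sum]
    exact Finset.sum_congr rfl fun j _ => by ring
  have hker : LinearMap.ker H.mulVecLin = M.pfKernel := by
    ext x
    rw [LinearMap.mem_ker, Matrix.mulVecLin_apply, SkGerm.mem_pfKernel, funext_iff]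
    simp only [hmul, Pi.zero_apply]
    constructor
    · intro h y
      rw [pi_eq_sum_univ' y, pfPolar_comm]
      simp only [map_sum, map_smul, LinearMap.sum_apply, LinearMap.smul_apply]
      refine Finset.sum_eq_zero fun i _ => ?_
      have := h i
      simp only [mul_eq_zero] at this
      rw [this.resolve_left (by norm_num), smul_zero]
    · intro h i
      rw [pfPolar_comm, h, mul_zero]
  have := H.mulVecLin.finrank_range_add_finrank_ker
  rw [hker] at this
  simpa [rankPfTwoJet, Matrix.rank] using this

/-! ### Cubic forms and their zeros -/

section Cubic

variable {E E' : Type*} [AddCommGroup E] [Module ℂ E] [AddCommGroup E'] [Module ℂ E']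

/-- A cubic form on a complex vector space. -/
def IsCubicForm (C : E → ℂ) : Prop :=
  ∃ T : E →ₗ[ℂ] E →ₗ[ℂ] E →ₗ[ℂ] ℂ, ∀ x, C x = T x x x

theorem IsCubicForm.comp {C : E → ℂ} (hC : IsCubicForm C) (f : E' →ₗ[ℂ] E) :
    IsCubicForm fun x => C (f x) := by
  obtain ⟨T, hT⟩ := hC
  refine ⟨LinearMap.mk₂ ℂ (fun x y => (T (f x) (f y)).comp f) ?_ ?_ ?_ ?_, fun x => hT _⟩ <;>
    intros <;> ext <;> simp

theorem IsCubicForm.map_smul {C : E → ℂ} (hC : IsCubicForm C) (t : ℂ) (x : E) :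
    C (t • x) = t ^ 3 * C x := by
  obtain ⟨T, hT⟩ := hC
  simp only [hT, _root_.map_smul, LinearMap.smul_apply, smul_eq_mul]
  ring

open Polynomial in
theorem IsCubicForm.exists_polynomial {C : E → ℂ} (hC : IsCubicForm C) (a b : E) :
    ∃ P : ℂ[X], P.coeff 3 = C b ∧ ∀ t : ℂ, P.eval t = C (a + t • b) := by
  obtain ⟨T, hT⟩ := hC
  refine ⟨Polynomial.C (T b b b) * X ^ 3 +
    Polynomial.C (T a b b + T b a b + T b b a) * X ^ 2 +
    Polynomial.C (T a a b + T a b a + T b a a) * X + Polynomial.C (T a a a), ?_, fun t => ?_⟩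
  · rw [hT]
    simp only [coeff_add, coeff_C_mul, coeff_X_pow, coeff_X, coeff_C]
    norm_num
  · simp only [hT, eval_add, eval_mul, eval_C, eval_pow, eval_X, map_add, LinearMap.add_apply,
      _root_.map_smul, LinearMap.smul_apply, smul_eq_mul]
    ring

/-- A cubic form has a zero in every plane. -/
theorem IsCubicForm.exists_zero {C : E → ℂ} (hC : IsCubicForm C) {a b : E}
    (hab : LinearIndependent ℂ ![a, b]) :
    ∃ v ∈ Submodule.span ℂ {a, b}, v ≠ 0 ∧ C v = 0 := by
  by_cases hb : C b = 0
  · exact ⟨b, Submodule.subset_span (by simp), hab.ne_zero 1, hb⟩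
  -- On the line `a + t b` the cubic is a polynomial in `t` whose coefficient of `t³` is `C b ≠ 0`,
  -- so it is nonconstant and has a root.
  obtain ⟨P, hP, hev⟩ := hC.exists_polynomial a b
  have hdeg : P.degree ≠ 0 := by
    intro h
    refine hb (hP ▸ Polynomial.coeff_eq_zero_of_degree_lt ?_)
    rw [h]
    exact_mod_cast (by norm_num : (0 : ℕ) < 3)
  obtain ⟨t, ht⟩ := Complex.exists_root (f := P) (by
    rcases lt_trichotomy P.degree 0 with h | h | h
    · have hP0 : P = 0 := by
        by_contra h0
        exact absurd h (not_lt.mpr (Polynomial.zero_le_degree_iff.mpr h0))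
      rw [hP0, Polynomial.coeff_zero] at hP
      exact absurd hP.symm hb
    · exact absurd h hdeg
    · exact h)
  refine ⟨a + t • b, add_mem (Submodule.subset_span (by simp))
    (Submodule.smul_mem _ _ (Submodule.subset_span (by simp))), fun h0 => ?_, ?_⟩
  · have := LinearIndependent.pair_iff.mp hab 1 t (by rw [one_smul, h0])
    exact one_ne_zero this.1
  · rw [← hev]; exact ht

end Cubic

/-! ### A measure-theoretic obstruction to finitely many classes -/

section Covering

open MeasureTheory

variable {m : ℕ}

theorem IsCubicForm.differentiable {C : (Fin m → ℂ) → ℂ} (hC : IsCubicForm C) :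
    Differentiable ℂ C := by
  obtain ⟨T, hT⟩ := hC
  have hexp : ∀ (f : (Fin m → ℂ) →ₗ[ℂ] ℂ) (x : Fin m → ℂ),
      f x = ∑ i, x i * f (Pi.single i 1) := fun f x => by
    conv_lhs => rw [pi_eq_sum_univ' x]
    simp
  have h : C = fun x => ∑ i, x i * ∑ j, x j * ∑ k, x k *
      T (Pi.single i 1) (Pi.single j 1) (Pi.single k 1) := by
    ext x
    rw [hT]
    refine (hexp ((T.flip x).flip x) x).trans (Finset.sum_congr rfl fun i _ => ?_)
    congr 1
    refine (hexp ((T (Pi.single i 1)).flip x) x).trans (Finset.sum_congr rfl fun j _ => ?_)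
    congr 1
    exact hexp (T (Pi.single i 1) (Pi.single j 1)) x
  rw [h]
  fun_prop

theorem differentiable_mulVec (v : Fin m → ℂ) :
    Differentiable ℂ fun G : Fin m → Fin m → ℂ => Matrix.mulVec G v := by
  unfold Matrix.mulVec dotProduct
  fun_prop

/-- The matrices carrying a fixed nonzero vector to a zero of a cubic form are negligible. -/
theorem IsCubicForm.volume_mulVec_eq_zero {C : (Fin m → ℂ) → ℂ} (hC : IsCubicForm C)
    {u v : Fin m → ℂ} (hu : C u ≠ 0) (hv : v ≠ 0) :
    Measure.addHaar {G : Fin m → Fin m → ℂ | C (Matrix.mulVec G v) = 0} = 0 := by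
  obtain ⟨i, hi⟩ := Function.ne_iff.mp hv
  simp only [Pi.zero_apply] at hi
  -- A matrix with `G₀ v = u`. Along each line `G + t G₀` the condition is a polynomial equation
  -- with `t³`-coefficient `C u ≠ 0`, hence has finitely many solutions. A Fubini argument then
  -- gives measure zero.
  let G₀ : Fin m → Fin m → ℂ := fun k => Pi.single i (u k / v i)
  have hG₀ : Matrix.mulVec G₀ v = u := by
    ext k
    simp only [Matrix.mulVec, G₀, single_dotProduct]
    field_simp
  have hcont : Continuous fun G : Fin m → Fin m → ℂ => C (Matrix.mulVec G v) := by
    exact hC.differentiable.continuous.comp (differentiable_mulVec v).continuous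
  have hmeas : MeasurableSet {G : Fin m → Fin m → ℂ | C (Matrix.mulVec G v) = 0}ᶜ :=
    (isClosed_singleton.preimage hcont).measurableSet.compl
  suffices hae : ∀ᵐ G ∂(Measure.addHaar : Measure (Fin m → Fin m → ℂ)),
      G ∈ {G : Fin m → Fin m → ℂ | C (Matrix.mulVec G v) = 0}ᶜ from
    measure_eq_zero_iff_ae_notMem.mpr hae
  refine ae_mem_of_ae_add_linearMap_mem (𝕜 := ℂ) (LinearMap.toSpanSingleton ℂ _ G₀)
    (volume : Measure ℂ) Measure.addHaar hmeas fun G => ?_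
  obtain ⟨P, hP, hev⟩ := hC.exists_polynomial (Matrix.mulVec G v) u
  have hP0 : P ≠ 0 := by
    rintro rfl
    exact hu (by rw [← hP, Polynomial.coeff_zero])
  have hfin : {t : ℂ | P.IsRoot t}.Finite := Polynomial.finite_setOfPred_isRoot hP0
  have hnull := hfin.measure_zero (volume : Measure ℂ)
  filter_upwards [measure_eq_zero_iff_ae_notMem.mp hnull] with t ht
  intro h0
  refine ht ?_
  have hlin : Matrix.mulVec (G + LinearMap.toSpanSingleton ℂ _ G₀ t) v =
      Matrix.mulVec G v + t • u := by
    rw [LinearMap.toSpanSingleton_apply, ← hG₀]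
    exact (Matrix.add_mulVec _ _ _).trans (congrArg _ (Matrix.smul_mulVec t _ _))
  change P.eval t = 0
  rw [hev, ← hlin]
  exact h0

/-- An open family of functions depending linearly and injectively on `m ^ 2` parameters, all
vanishing at a fixed nonzero vector, is not covered by the linear changes of coordinates of finitely
many cubic forms in `m` variables. -/
theorem not_covered_by_finite_cubics {ι κ : Type*} [Finite κ] {F : Set ι} (hF : F.Finite)
    {C : ι → (Fin m → ℂ) → ℂ} (hC : ∀ N, IsCubicForm (C N))
    {Φ : (Fin m → Fin m → ℂ) →ₗ[ℂ] (Fin m → ℂ) → ℂ} (X : κ → Fin m → ℂ)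
    (hX : ∀ p, (∀ k, Φ p (X k) = 0) → p = 0) {c₀ : (Fin m → ℂ) → ℂ} {v : Fin m → ℂ} (hv : v ≠ 0)
    (hv₀ : c₀ v = 0) (hvΦ : ∀ p, Φ p v = 0)
    (h : ∀ᶠ p in 𝓝 0, ∃ N ∈ F, ∃ G : Fin m → Fin m → ℂ,
      ∀ x, c₀ x + Φ p x = C N (Matrix.mulVec G x)) : False := by
  have := Fintype.ofFinite κ
  let R : (Fin m → Fin m → ℂ) →ₗ[ℂ] κ → ℂ := (LinearMap.funLeft ℂ ℂ X).comp Φ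
  have hR : LinearMap.ker R = ⊥ := by
    rw [LinearMap.ker_eq_bot']
    exact fun p hp => hX p fun k => congrFun hp k
  obtain ⟨r, hr⟩ := R.exists_leftInverse_of_injective hR
  -- If `G` carries `C N` to the member with parameter `p`, then `Ψ N G = p`: the parameter is
  -- recovered from values at the points `X k`.
  let Ψ : ι → (Fin m → Fin m → ℂ) → Fin m → Fin m → ℂ := fun N G =>
    LinearMap.toContinuousLinearMap r fun k => C N (Matrix.mulVec G (X k)) - c₀ (X k)
  have hΨ : ∀ N, Differentiable ℂ (Ψ N) := by
    intro N
    refine (ContinuousLinearMap.differentiable _).comp (differentiable_pi.mpr fun k => ?_)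
    exact ((hC N).differentiable.comp (differentiable_mulVec (X k))).sub_const _
  have hnull : ∀ N, Measure.addHaar (Ψ N '' {G | C N (Matrix.mulVec G v) = 0}) = 0 := by
    intro N
    by_cases hu : ∃ u, C N u ≠ 0
    · obtain ⟨u, hu⟩ := hu
      exact addHaar_image_eq_zero_of_differentiableOn_of_addHaar_eq_zero Measure.addHaar
        ((hΨ N).restrictScalars ℝ).differentiableOn ((hC N).volume_mulVec_eq_zero hu hv)
    -- For the zero form the set of `G` is not null, but `Ψ N` is constant and a point is null
    -- because `m > 0`.
    · push Not at hu
      have hm : Nonempty (Fin m) := by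
        obtain ⟨i, -⟩ := Function.ne_iff.mp hv
        exact ⟨i⟩
      have := Module.punctured_nhds_neBot ℝ (Fin m → Fin m → ℂ) 0
      refine measure_mono_null (t := {Ψ N 0}) ?_ (measure_singleton _)
      rintro _ ⟨G, -, rfl⟩
      simp [Ψ, hu]
  have hcover : {p : Fin m → Fin m → ℂ | ∃ N ∈ F, ∃ G : Fin m → Fin m → ℂ,
      ∀ x, c₀ x + Φ p x = C N (Matrix.mulVec G x)} ⊆
      ⋃ N ∈ F, Ψ N '' {G | C N (Matrix.mulVec G v) = 0} := by
    rintro p ⟨N, hN, G, hG⟩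
    refine Set.mem_biUnion hN ⟨G, ?_, ?_⟩
    · rw [Set.mem_ofPred_eq, ← hG, hv₀, hvΦ, add_zero]
    · have e : (fun k => C N (Matrix.mulVec G (X k)) - c₀ (X k)) = R p := by
        ext k
        rw [← hG, add_sub_cancel_left]
        rfl
      change r _ = p
      rw [e]
      exact congrArg (fun f : (Fin m → Fin m → ℂ) →ₗ[ℂ] (Fin m → Fin m → ℂ) => f p) hr
  have hpos := Measure.measure_pos_of_mem_nhds (Measure.addHaar : Measure (Fin m → Fin m → ℂ)) h
  refine hpos.ne' (measure_mono_null hcover ?_)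
  exact (measure_biUnion_null_iff hF.countable).mpr fun N _ => hnull N

end Covering

/-! ### The cubic monomials divisible by `x₀` or `x₁`, indexed by `m²` pairs -/

section Monomials

variable {r : ℕ}

/-- The first factor of the monomial `x_a x_i x_b` attached to a pair of indices. -/
def leftIndex (i j : Fin (r + 3)) : Fin 2 := if i ≤ j then 0 else 1

/-- The last factor of the monomial `x_a x_i x_b` attached to a pair of indices. -/
def rightIndex (i j : Fin (r + 3)) : Fin (r + 3) := if i ≤ j then j else j + 1

/-- The exponent of the monomial attached to a pair of indices. -/
noncomputable def pairExponent (i j : Fin (r + 3)) : Fin (r + 3) →₀ ℕ :=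
  Finsupp.single (Fin.castLE (by omega) (leftIndex i j)) 1 + Finsupp.single i 1 +
    Finsupp.single (rightIndex i j) 1

/-- For `i ≤ j` the monomial is `x₀ x_i x_j`; for `i > j` it is `x₁ x_i x_{j+1}` with `1 ≤ j + 1 ≤
i`, which does not involve `x₀`. So the two kinds are disjoint, and within each kind the order of
the two indices removes the symmetry. -/
theorem pairExponent_injective {i j k l : Fin (r + 3)}
    (h : pairExponent i j = pairExponent k l) : i = k ∧ j = l := by
  have hs : ∀ {i j : Fin (r + 3)}, ¬ i ≤ j → ((j + 1 : Fin (r + 3)) : ℕ) = j + 1 :=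
    fun {i j} hij => Fin.val_add_one_of_lt' (by omega)
  have hmixed : ∀ {i j k l : Fin (r + 3)}, i ≤ j → ¬ k ≤ l →
      pairExponent i j ≠ pairExponent k l := by
    intro i j k l hij hkl h
    have h0 := DFunLike.congr_fun h 0
    have hk : k ≠ 0 := fun h => hkl (h ▸ Fin.zero_le l)
    have hl : l + 1 ≠ 0 := fun h => by
      have := hs hkl
      rw [h] at this
      simp at this
    have h10 : (Fin.castLE (by omega) (1 : Fin 2) : Fin (r + 3)) ≠ 0 := by simp [Fin.ext_iff]
    simp [pairExponent, leftIndex, rightIndex, hij, hkl, Finsupp.single_apply, hk, hl, h10] at h0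
  by_cases hij : i ≤ j <;> by_cases hkl : k ≤ l
  · simp only [pairExponent, leftIndex, rightIndex, hij, hkl, if_true, add_assoc,
      add_right_inj] at h
    rw [Finsupp.single_add_single_eq_single_add_single one_ne_zero one_ne_zero] at h
    simp only [Fin.ext_iff] at *
    omega
  · exact absurd h (hmixed hij hkl)
  · exact absurd h.symm (hmixed hkl hij)
  · have h1 := hs hij
    have h2 := hs hkl
    simp only [pairExponent, leftIndex, rightIndex, hij, hkl, if_false, add_assoc,
      add_right_inj] at h
    rw [Finsupp.single_add_single_eq_single_add_single one_ne_zero one_ne_zero] at h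
    simp only [Fin.ext_iff] at *
    omega

/-- A combination of the cubic monomials `x_a x_i x_b` vanishing on a grid is zero. -/
theorem eq_zero_of_monomials_eq_zero (p : Fin (r + 3) → Fin (r + 3) → ℂ)
    (h : ∀ k : Fin (r + 3) → Fin 4, ∑ i, ∑ j, p i j *
      (((k (Fin.castLE (by omega) (leftIndex i j)) : ℕ) : ℂ) * ((k i : ℕ) : ℂ) *
        ((k (rightIndex i j) : ℕ) : ℂ)) = 0) : p = 0 := by
  let P : MvPolynomial (Fin (r + 3)) ℂ :=
    ∑ i, ∑ j, MvPolynomial.monomial (pairExponent i j) (p i j)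
  -- Each variable has degree at most three, fewer than the four grid values `0, 1, 2, 3`.
  have hP : P = 0 := by
    refine MvPolynomial.eq_zero_of_eval_zero_at_prod_finset P
      (fun _ => Finset.univ.image fun n : Fin 4 => ((n : ℕ) : ℂ)) (fun i => ?_) (fun x hx => ?_)
    · rw [Finset.card_image_of_injective _ (fun a b hab => Fin.ext (by exact_mod_cast hab)),
        Finset.card_univ, Fintype.card_fin, Nat.lt_succ_iff]
      refine (MvPolynomial.degreeOf_le_totalDegree _ _).trans ?_
      refine MvPolynomial.totalDegree_finsetSum_le fun i _ => ?_
      refine MvPolynomial.totalDegree_finsetSum_le fun j _ => ?_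
      refine (MvPolynomial.totalDegree_monomial_le _ _).trans ?_
      simp [pairExponent, Finsupp.sum_add_index']
    · have hx' : ∀ i, ∃ n : Fin 4, ((n : ℕ) : ℂ) = x i := fun i => by
        simpa using hx i
      choose k hk using hx'
      rw [← h k]
      simp only [P, map_sum, MvPolynomial.eval_monomial, pairExponent, hk]
      refine Finset.sum_congr rfl fun i _ => Finset.sum_congr rfl fun j _ => ?_
      simp [Finsupp.prod_add_index', pow_add]
  ext i j
  have hc := congrArg (MvPolynomial.coeff (pairExponent i j)) hP
  simp only [P, MvPolynomial.coeff_sum, MvPolynomial.coeff_monomial, MvPolynomial.coeff_zero] at hc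
  rw [Finset.sum_eq_single i, Finset.sum_eq_single j, if_pos rfl] at hc
  · exact hc
  · exact fun l _ hl => if_neg fun he => hl (pairExponent_injective he).2
  · simp
  · exact fun k _ hk => Finset.sum_eq_zero fun l _ =>
      if_neg fun he => hk (pairExponent_injective he).1
  · simp

end Monomials

/-! ### Linear perturbations of germs and of their jets -/

section TwoJet

variable {F : Type*} [NormedAddCommGroup F] [NormedSpace ℂ F]

theorem HasTwoJet.add {a b : ℂ → F} {a₁ a₂ b₁ b₂ : F} (ha : HasTwoJet a a₁ a₂)
    (hb : HasTwoJet b b₁ b₂) : HasTwoJet (fun t => a t + b t) (a₁ + b₁) (a₂ + b₂) := by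
  refine (Tendsto.add ha hb).congr fun t => ?_
  simp only [smul_sub, smul_add]
  abel

theorem HasTwoJet.const_smul {a : ℂ → F} {a₁ a₂ : F} (ha : HasTwoJet a a₁ a₂) (c : ℂ) :
    HasTwoJet (fun t => c • a t) (c • a₁) (c • a₂) := by
  refine (Tendsto.const_smul ha c).congr fun t => ?_
  module

theorem HasTwoJet.sum {ι : Type*} (u : Finset ι) {a : ι → ℂ → F} {a₁ a₂ : ι → F}
    (ha : ∀ i, HasTwoJet (a i) (a₁ i) (a₂ i)) :
    HasTwoJet (fun t => ∑ i ∈ u, a i t) (∑ i ∈ u, a₁ i) (∑ i ∈ u, a₂ i) := by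
  refine (tendsto_finsetSum u fun i _ => ha i).congr fun t => ?_
  rw [← Finset.smul_sum, Finset.sum_sub_distrib, Finset.smul_sum]

end TwoJet

theorem iteratedFDeriv_add_sum_smul {E ι : Type*} [NormedAddCommGroup E] [NormedSpace ℂ E]
    [Fintype ι] {l : ℕ} {x : E} {f : E → ℂ} {g : ι → E → ℂ} (p : ι → ℂ) (hf : ContDiffAt ℂ l f x)
    (hg : ∀ i, ContDiffAt ℂ l (g i) x) :
    iteratedFDeriv ℂ l (fun y => f y + ∑ i, p i * g i y) x =
      iteratedFDeriv ℂ l f x + ∑ i, p i • iteratedFDeriv ℂ l (g i) x := by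
  have hp : ∀ i ∈ Finset.univ, ContDiffAt ℂ l (p i • g i) x := fun i _ => (hg i).const_smul (p i)
  have hs : ContDiffAt ℂ l (∑ i, p i • g i) x := by
    rw [show ∑ i, p i • g i = fun y => ∑ i, (p i • g i) y by ext; simp]
    exact ContDiffAt.sum hp
  rw [show (fun y => f y + ∑ i, p i * g i y) = f + ∑ i, p i • g i by ext; simp,
    iteratedFDeriv_add_apply hf hs, iteratedFDeriv_sum_apply hp]
  simp only [iteratedFDeriv_const_smul_apply (hg _)]

namespace SkGerm

variable {n : ℕ} {ι : Type*} [Fintype ι]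

/-- The perturbation of a germ by a linear combination of germs. -/
def perturb (M : SkGerm s n) (D : ι → SkGerm s n) (p : ι → ℂ) : SkGerm s n where
  toFun x := M.toFun x + ∑ i, p i • (D i).toFun x
  analytic a b := by
    simp only [Matrix.add_apply, Matrix.sum_apply, Matrix.smul_apply, smul_eq_mul]
    exact (M.analytic a b).add (Finset.analyticAt_fun_sum _ fun i _ =>
      analyticAt_const.mul ((D i).analytic a b))
  skew := by
    filter_upwards [M.skew, eventually_all.mpr fun i => (D i).skew] with x hM hD
    simp only [Matrix.transpose_add, Matrix.transpose_sum, Matrix.transpose_smul, hM, hD,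
      smul_neg, Finset.sum_neg_distrib, neg_add]
  map_zero := by simp [M.map_zero, fun i => (D i).map_zero]

theorem jet_perturb (M : SkGerm s n) (D : ι → SkGerm s n) (p : ι → ℂ) (k : ℕ) :
    (M.perturb D p).jet k = M.jet k + ∑ i, p i • (D i).jet k := by
  ext1 l
  ext1 a
  ext1 b
  have h := iteratedFDeriv_add_sum_smul (l := (l : ℕ)) (x := (0 : Fin s → ℂ))
    (f := fun x => M.toFun x a b) (g := fun i x => (D i).toFun x a b) p
    (M.analytic a b).contDiffAt (fun i => ((D i).analytic a b).contDiffAt)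
  simp only [Pi.add_apply, Finset.sum_apply, Pi.smul_apply, jet]
  rw [← h]
  congr 1
  ext x
  simp [perturb, Matrix.sum_apply]

theorem eventually_jet_perturb_mem (M : SkGerm s n) (D : ι → SkGerm s n) {k : ℕ}
    {U : Set (JetSpace s n k)} (hU : U ∈ 𝓝 (M.jet k)) :
    ∀ᶠ p in 𝓝 (0 : ι → ℂ), (M.perturb D p).jet k ∈ U := by
  have hc : Continuous fun p : ι → ℂ => M.jet k + ∑ i, p i • (D i).jet k := by fun_prop
  have ht := hc.tendsto 0
  have h0 : M.jet k + ∑ i, (0 : ι → ℂ) i • (D i).jet k = M.jet k :=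
    add_eq_left.mpr (Finset.sum_eq_zero fun i _ => zero_smul ℂ ((D i).jet k))
  rw [h0] at ht
  filter_upwards [ht hU] with p hp
  rw [jet_perturb]
  exact hp

/-- The germ with given entries above the diagonal. -/
def ofCoords (f : (Fin s → ℂ) → Fin 6 → ℂ) (hf : AnalyticAt ℂ f 0) (h0 : f 0 = 0) :
    SkGerm s 4 where
  toFun x := skewMatrix (f x)
  analytic a b := by
    have h := analyticAt_pi_iff.mp hf
    have hz : AnalyticAt ℂ (fun _ : Fin s → ℂ => (0 : ℂ)) 0 := analyticAt_const
    fin_cases a <;> fin_cases b <;>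
      first | exact hz | exact h _ | exact (h _).neg
  skew := Eventually.of_forall fun x => transpose_skewMatrix _
  map_zero := by rw [h0, skewMatrix_zero]

theorem coords_ofCoords (f : (Fin s → ℂ) → Fin 6 → ℂ) (hf : AnalyticAt ℂ f 0) (h0 : f 0 = 0) :
    (ofCoords f hf h0).coords = f :=
  funext fun _ => upperEntries_skewMatrix _

theorem lin_quad_perturb (M : SkGerm s 4) (D : ι → SkGerm s 4) (p : ι → ℂ) (x : Fin s → ℂ) :
    (M.perturb D p).lin x = M.lin x + ∑ i, p i • (D i).lin x ∧
      (M.perturb D p).quad x x = M.quad x x + ∑ i, p i • (D i).quad x x := by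
  refine ((M.perturb D p).hasTwoJet_coords x).unique ?_
  have h := (M.hasTwoJet_coords x).add
    (HasTwoJet.sum Finset.univ fun i => ((D i).hasTwoJet_coords x).const_smul (p i))
  have e : ∀ y, (M.perturb D p).coords y = M.coords y + ∑ i, p i • (D i).coords y := by
    intro y
    ext j
    fin_cases j <;> simp [coords, perturb, upperEntries, Matrix.sum_apply]
  simpa only [e] using h

theorem isCubicForm_cubic (M : SkGerm s 4) : IsCubicForm M.cubic := by
  let q : (Fin s → ℂ) →ₗ[ℂ] (Fin s → ℂ) →ₗ[ℂ] (Fin 6 → ℂ) :=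
    LinearMap.mk₂ ℂ (fun x y => M.quad x y) (by simp) (by simp) (by simp) (by simp)
  exact ⟨LinearMap.mk₂ ℂ (fun x y => (pfPolar (M.lin x)).comp (q y))
    (by intros; ext; simp) (by intros; ext; simp) (by intros; ext; simp) (by intros; ext; simp),
    fun x => rfl⟩

end SkGerm

/-! ### Linear algebra of isotropic vectors -/

section LinearAlgebra

variable {E : Type*} [AddCommGroup E] [Module ℂ E]

theorem exists_dual_eq_one {P : Submodule ℂ E} {x : E} (hx : x ∉ P) :
    ∃ f : E →ₗ[ℂ] ℂ, f x = 1 ∧ ∀ y ∈ P, f y = 0 := by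
  obtain ⟨f, hf, hP⟩ := Submodule.exists_le_ker_of_notMem hx
  refine ⟨(f x)⁻¹ • f, by simp [hf], fun y hy => ?_⟩
  have : f y = 0 := hP hy
  simp [this]

/-- A space of dimension at least `3` contains a plane independent of a given vector. -/
theorem exists_pair_mod_span [FiniteDimensional ℂ E] {P : Submodule ℂ E}
    (hP : 3 ≤ Module.finrank ℂ P) (w : E) :
    ∃ y ∈ P, ∃ z ∈ P, ∀ a b : ℂ, a • y + b • z ∈ Submodule.span ℂ {w} → a = 0 ∧ b = 0 := by
  have hex : ∀ u : Finset E, u.card ≤ 2 → ∃ y ∈ P, y ∉ Submodule.span ℂ (u : Set E) := by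
    intro u hu
    by_contra! hle
    have h1 := Submodule.finrank_mono (show P ≤ Submodule.span ℂ (u : Set E) from hle)
    have h2 := finrank_span_finset_le_card (R := ℂ) u
    rw [Set.finrank] at h2
    omega
  classical
  obtain ⟨y, hy, hyw⟩ := hex {w} (by simp)
  obtain ⟨z, hz, hzw⟩ := hex {w, y} Finset.card_le_two
  simp only [Finset.coe_singleton, Finset.coe_insert] at hyw hzw
  refine ⟨y, hy, z, hz, fun a b h => ?_⟩
  have hb : b = 0 := by
    by_contra hb
    refine hzw ?_
    have h1 : a • y + b • z ∈ Submodule.span ℂ {w, y} :=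
      Submodule.span_mono (by simp) h
    have h2 : y ∈ Submodule.span ℂ {w, y} := Submodule.subset_span (by simp)
    have h3 := (Submodule.add_mem_iff_right _ (Submodule.smul_mem _ a h2)).mp h1
    exact (Submodule.smul_mem_iff _ hb).mp h3
  refine ⟨?_, hb⟩
  by_contra ha
  rw [hb, zero_smul, add_zero] at h
  exact hyw ((Submodule.smul_mem_iff _ ha).mp h)

/-- There is an isotropic vector orthogonal to two given ones and not a multiple of the second. -/
theorem exists_isotropic (u w : Fin 6 → ℂ) :
    ∃ w', pf w' = 0 ∧ pfPolar u w' = 0 ∧ pfPolar w w' = 0 ∧ w' ∉ Submodule.span ℂ {w} := by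
  set T : (Fin 6 → ℂ) →ₗ[ℂ] ℂ × ℂ := (pfPolar u).prod (pfPolar w) with hT
  have hdim : 3 ≤ Module.finrank ℂ (LinearMap.ker T) := by
    have h1 := T.finrank_range_add_finrank_ker
    have h2 := Submodule.finrank_le (LinearMap.range T)
    rw [Module.finrank_fin_fun] at h1
    simp only [Module.finrank_prod, Module.finrank_self] at h2
    omega
  have hker : ∀ y ∈ LinearMap.ker T, pfPolar u y = 0 ∧ pfPolar w y = 0 := fun y hy => by
    simpa [hT, Prod.ext_iff] using hy
  obtain ⟨y, hy, z, hz, hyz⟩ := exists_pair_mod_span hdim w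
  by_cases hz0 : pf z = 0
  · refine ⟨z, hz0, (hker z hz).1, (hker z hz).2, fun hzw => ?_⟩
    exact one_ne_zero (hyz 0 1 (by simpa using hzw)).2
  -- Over `ℂ` the discriminant is a square, so the quadratic `pf (y + b z)` in `b` has a root.
  · obtain ⟨δ, hδ⟩ := IsAlgClosed.exists_pow_nat_eq (discrim (pf z) (pfPolar y z) (pf y))
      (n := 2) (by norm_num)
    obtain ⟨b, hb⟩ := exists_quadratic_eq_zero hz0 ⟨δ, by rw [← hδ, sq]⟩
    have hmem : y + b • z ∈ LinearMap.ker T := add_mem hy (Submodule.smul_mem _ _ hz)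
    refine ⟨y + b • z, ?_, (hker _ hmem).1, (hker _ hmem).2, fun hw => ?_⟩
    · rw [pf_add, pf_smul, map_smul, smul_eq_mul]
      linear_combination hb
    · exact one_ne_zero (hyz 1 b (by simpa using hw)).1

end LinearAlgebra

theorem analyticAt_linearMap {F : Type*} [NormedAddCommGroup F] [NormedSpace ℂ F]
    (T : (Fin s → ℂ) →ₗ[ℂ] F) : AnalyticAt ℂ (fun x => T x) 0 :=
  (LinearMap.toContinuousLinearMap T).analyticAt 0

theorem analyticAt_mul_smul (f g : (Fin s → ℂ) →ₗ[ℂ] ℂ) (w : Fin 6 → ℂ) :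
    AnalyticAt ℂ (fun x => (f x * g x) • w) 0 :=
  ((analyticAt_linearMap f).mul (analyticAt_linearMap g)).smul analyticAt_const

/-! ### Bringing the linear part on the radical into general position -/

namespace SkGerm

/-- The germ with a given linear map as its entries above the diagonal. -/
noncomputable def ofLinear (T : (Fin s → ℂ) →ₗ[ℂ] (Fin 6 → ℂ)) : SkGerm s 4 :=
  ofCoords (fun x => T x) (analyticAt_linearMap T) (_root_.map_zero T)

theorem lin_ofLinear (T : (Fin s → ℂ) →ₗ[ℂ] (Fin 6 → ℂ)) (x : Fin s → ℂ) :
    (ofLinear T).lin x = T x := by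
  refine ((ofLinear T).hasTwoJet_coords x |>.unique (b₂ := 0) ?_).1
  rw [ofLinear, coords_ofCoords]
  simpa using hasTwoJet_smul_const (T x)

/-- The germ whose entries above the diagonal are given by a product of linear forms. -/
noncomputable def ofProduct (f g : (Fin s → ℂ) →ₗ[ℂ] ℂ) (w : Fin 6 → ℂ) : SkGerm s 4 :=
  ofCoords (fun x => (f x * g x) • w) (analyticAt_mul_smul f g w) (by simp)

theorem lin_quad_ofProduct (f g : (Fin s → ℂ) →ₗ[ℂ] ℂ) (w : Fin 6 → ℂ) (x : Fin s → ℂ) :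
    (ofProduct f g w).lin x = 0 ∧ (ofProduct f g w).quad x x = (f x * g x) • w := by
  refine (ofProduct f g w).hasTwoJet_coords x |>.unique ?_
  rw [ofProduct, coords_ofCoords]
  refine tendsto_const_nhds.congr' ?_
  filter_upwards [self_mem_nhdsWithin] with t ht
  have ht : t ≠ 0 := ht
  simp only [map_smul, smul_eq_mul, smul_zero, sub_zero, smul_smul]
  congr 1
  field_simp

/-- A germ whose Pfaffian has a quadratic part of rank at most one can be perturbed so that its
linear part has rank at least two on the radical. -/
theorem exists_perturb_two_le_rank (M : SkGerm s 4) (hK : 3 ≤ Module.finrank ℂ M.pfKernel)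
    (hrank : rankPfTwoJet M ≤ 1) {k : ℕ} {U : Set (JetSpace s 4 k)} (hU : U ∈ 𝓝 (M.jet k)) :
    ∃ M' : SkGerm s 4, M'.jet k ∈ U ∧ 3 ≤ Module.finrank ℂ M'.pfKernel ∧
      ∃ k₁ ∈ M'.pfKernel, ∃ k₂ ∈ M'.pfKernel, ∀ a b : ℂ,
        a • M'.lin k₁ + b • M'.lin k₂ = 0 → a = 0 ∧ b = 0 := by
  by_cases hgood : ∃ k₁ ∈ M.pfKernel, ∃ k₂ ∈ M.pfKernel, ∀ a b : ℂ,
      a • M.lin k₁ + b • M.lin k₂ = 0 → a = 0 ∧ b = 0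
  · exact ⟨M, mem_of_mem_nhds hU, hK, hgood⟩
  -- Rank at most one means that the radical together with one vector `t` spans everything.
  obtain ⟨t, ht⟩ : ∃ t, ∀ x, ∃ y ∈ M.pfKernel, ∃ c : ℂ, x = y + c • t := by
    have h1 : Module.finrank ℂ ((Fin s → ℂ) ⧸ M.pfKernel) ≤ 1 := by
      have h2 := M.pfKernel.finrank_quotient_add_finrank
      have h3 := rankPfTwoJet_add_finrank_pfKernel M
      rw [Module.finrank_fin_fun] at h2
      omega
    obtain ⟨q, hq⟩ := finrank_le_one_iff.mp h1
    obtain ⟨t, rfl⟩ := M.pfKernel.mkQ_surjective q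
    refine ⟨t, fun x => ?_⟩
    obtain ⟨c, hc⟩ := hq (M.pfKernel.mkQ x)
    refine ⟨x - c • t, ?_, c, by abel⟩
    rw [← Submodule.ker_mkQ M.pfKernel, LinearMap.mem_ker, map_sub, map_smul, hc, sub_self]
  have hKK : ∀ x ∈ M.pfKernel, ∀ y, pfPolar (M.lin x) (M.lin y) = 0 :=
    fun x hx => mem_pfKernel.mp hx
  -- The image of the radical under the linear part is at most a line, and it is isotropic and
  -- orthogonal to `M.lin t`. If the image is zero, any nonzero isotropic vector orthogonal to
  -- `M.lin t` serves.
  obtain ⟨w, hw0, hww, hwt, hwK⟩ : ∃ w, w ≠ 0 ∧ pf w = 0 ∧ pfPolar w (M.lin t) = 0 ∧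
      ∀ x ∈ M.pfKernel, ∃ c : ℂ, M.lin x = c • w := by
    by_cases hz : ∃ x ∈ M.pfKernel, M.lin x ≠ 0
    · obtain ⟨x, hx, hx0⟩ := hz
      refine ⟨M.lin x, hx0, ?_, hKK x hx t, fun y hy => ?_⟩
      · have := pfPolar_self (M.lin x)
        rw [hKK x hx x] at this
        simpa using this.symm
      · push Not at hgood
        obtain ⟨a, b, hab, hne⟩ := hgood x hx y hy
        have hb : b ≠ 0 := by
          rintro rfl
          rw [zero_smul, add_zero] at hab
          exact hne ((smul_eq_zero.mp hab).resolve_right hx0) rfl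
        refine ⟨-(b⁻¹ * a), ?_⟩
        rw [neg_smul, mul_smul, ← smul_neg, ← eq_neg_of_add_eq_zero_right hab, smul_smul,
          inv_mul_cancel₀ hb, one_smul]
    · push Not at hz
      obtain ⟨w, h1, h2, -, h4⟩ := exists_isotropic (M.lin t) 0
      refine ⟨w, fun h => h4 (by simp [h]), h1, by rw [pfPolar_comm, h2],
        fun x hx => ⟨0, by rw [hz x hx, zero_smul]⟩⟩
  obtain ⟨w', hw', hw't, hww', hind⟩ := exists_isotropic (M.lin t) w
  obtain ⟨k₁, hk₁, k₂, hk₂, hk, hLk₂⟩ : ∃ k₁ ∈ M.pfKernel, ∃ k₂ ∈ M.pfKernel,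
      (∀ a b : ℂ, a • k₁ + b • k₂ = 0 → a = 0 ∧ b = 0) ∧ M.lin k₂ = 0 := by
    obtain ⟨y, hy, z, hz, hyz⟩ := exists_pair_mod_span hK 0
    simp only [Submodule.span_zero_singleton, Submodule.mem_bot] at hyz
    obtain ⟨α, hα⟩ := hwK y hy
    obtain ⟨β, hβ⟩ := hwK z hz
    by_cases hα0 : α = 0
    · refine ⟨z, hz, y, hy, fun a b h => ?_, by rw [hα, hα0, zero_smul]⟩
      exact (hyz b a (by rw [add_comm]; exact h)).symm
    · refine ⟨y, hy, z - (β / α) • y, sub_mem hz (Submodule.smul_mem _ _ hy), fun a b h => ?_, ?_⟩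
      · obtain ⟨h1, h2⟩ := hyz (a - b * (β / α)) b (by rw [← h]; module)
        subst h2
        exact ⟨by simpa using h1, rfl⟩
      · rw [map_sub, map_smul, hα, hβ, smul_smul, div_mul_cancel₀ _ hα0, sub_self]
  obtain ⟨f, hf1, hf2⟩ : ∃ f : (Fin s → ℂ) →ₗ[ℂ] ℂ, f k₁ = 1 ∧ f k₂ = 0 := by
    obtain ⟨f, h1, h2⟩ := exists_dual_eq_one (P := Submodule.span ℂ {k₂}) (x := k₁) (fun h => by
      obtain ⟨c, hc⟩ := Submodule.mem_span_singleton.mp h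
      exact one_ne_zero (hk 1 (-c) (by rw [← hc]; module)).1)
    exact ⟨f, h1, h2 _ (Submodule.mem_span_singleton_self _)⟩
  obtain ⟨g, hg2, hg1⟩ : ∃ g : (Fin s → ℂ) →ₗ[ℂ] ℂ, g k₂ = 1 ∧ g k₁ = 0 := by
    obtain ⟨f, h1, h2⟩ := exists_dual_eq_one (P := Submodule.span ℂ {k₁}) (x := k₂) (fun h => by
      obtain ⟨c, hc⟩ := Submodule.mem_span_singleton.mp h
      exact one_ne_zero (hk (-c) 1 (by rw [← hc]; module)).2)
    exact ⟨f, h1, h2 _ (Submodule.mem_span_singleton_self _)⟩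
  obtain ⟨a₁, ha₁⟩ := hwK k₁ hk₁
  -- The new values on the radical stay in `span {w, w'}`, which is totally isotropic and orthogonal
  -- to `M.lin t`, so the radical cannot shrink. Meanwhile `k₁ ↦ (a₁ + ε) w` and `k₂ ↦ ε w'` become
  -- independent.
  let D : Unit → SkGerm s 4 := fun _ => ofLinear (f.smulRight w + g.smulRight w')
  have hlin : ∀ (ε : ℂ) x, (M.perturb D fun _ => ε).lin x =
      M.lin x + ε • (f x • w + g x • w') := by
    intro ε x
    rw [(lin_quad_perturb M D _ x).1]
    simp [D, lin_ofLinear]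
  have hev : ∀ᶠ ε in 𝓝[≠] (0 : ℂ), ε ≠ 0 ∧ a₁ + ε ≠ 0 ∧ (M.perturb D fun _ => ε).jet k ∈ U := by
    have h1 : ∀ᶠ ε in 𝓝[≠] (0 : ℂ), ε ≠ 0 := self_mem_nhdsWithin
    have h2 : ∀ᶠ ε in 𝓝[≠] (0 : ℂ), a₁ + ε ≠ 0 := by
      by_cases ha : a₁ = 0
      · simpa [ha] using h1
      · have hc : Tendsto (fun ε : ℂ => a₁ + ε) (𝓝 0) (𝓝 (a₁ + 0)) :=
          tendsto_const_nhds.add tendsto_id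
        rw [add_zero] at hc
        exact (hc.eventually_ne ha).filter_mono nhdsWithin_le_nhds
    have h3 : ∀ᶠ ε in 𝓝[≠] (0 : ℂ), (M.perturb D fun _ => ε).jet k ∈ U := by
      have hc : Continuous fun (ε : ℂ) (_ : Unit) => ε := by fun_prop
      exact ((hc.tendsto 0).eventually (M.eventually_jet_perturb_mem D hU)).filter_mono
        nhdsWithin_le_nhds
    exact h1.and (h2.and h3)
  obtain ⟨ε, hε, hε', hjet⟩ := hev.exists
  have hww2 : pfPolar w w = 0 := by rw [pfPolar_self, hww, mul_zero]
  have hww3 : pfPolar w' w' = 0 := by rw [pfPolar_self, hw', mul_zero]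
  have hle : M.pfKernel ≤ (M.perturb D fun _ => ε).pfKernel := by
    intro x hx
    rw [mem_pfKernel]
    intro y
    obtain ⟨z, hz, c, rfl⟩ := ht y
    obtain ⟨α, hα⟩ := hwK x hx
    obtain ⟨β, hβ⟩ := hwK z hz
    simp only [hlin, map_add, map_smul, hα, hβ, LinearMap.add_apply, LinearMap.smul_apply,
      smul_eq_mul, hww2, hww3, hww', hwt, pfPolar_comm w' w, pfPolar_comm w' (M.lin t), hw't]
    ring
  refine ⟨_, hjet, hK.trans (Submodule.finrank_mono hle), k₁, hle hk₁, k₂, hle hk₂,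
    fun a b hab => ?_⟩
  simp only [hlin, hf1, hf2, hg1, hg2, ha₁, hLk₂, zero_smul, one_smul, add_zero, zero_add] at hab
  have hb : b * ε = 0 := by
    by_contra hb
    refine hind (Submodule.mem_span_singleton.mpr ⟨-((b * ε)⁻¹ * (a * (a₁ + ε))), ?_⟩)
    have h1 : (b * ε) • w' = -((a * (a₁ + ε)) • w) := by
      rw [eq_neg_iff_add_eq_zero, ← hab]; module
    rw [neg_smul, mul_smul, ← smul_neg, ← h1, smul_smul, inv_mul_cancel₀ hb, one_smul]
  have ha : (a * (a₁ + ε)) • w = 0 := by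
    rw [smul_smul, hb] at hab
    rw [← hab]; module
  exact ⟨(mul_eq_zero.mp ((smul_eq_zero.mp ha).resolve_right hw0)).resolve_right hε',
    (mul_eq_zero.mp hb).resolve_right hε⟩

/-- A zero of the cubic part together with a plane of the radical on which the linear part is
injective modulo the image of that zero. -/
theorem exists_cubic_zero (M : SkGerm s 4) (hK : 3 ≤ Module.finrank ℂ M.pfKernel)
    (hrank : ∃ k₁ ∈ M.pfKernel, ∃ k₂ ∈ M.pfKernel, ∀ a b : ℂ,
        a • M.lin k₁ + b • M.lin k₂ = 0 → a = 0 ∧ b = 0) :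
    ∃ v ∈ M.pfKernel, v ≠ 0 ∧ M.cubic v = 0 ∧ ∃ y ∈ M.pfKernel, ∃ z ∈ M.pfKernel,
      ∀ a b : ℂ, a • M.lin y + b • M.lin z ∈ Submodule.span ℂ {M.lin v} → a = 0 ∧ b = 0 := by
  by_cases hker : ∃ v ∈ M.pfKernel, v ≠ 0 ∧ M.lin v = 0
  -- A kernel vector of the linear part is a zero of the cubic for free, and its image imposes no
  -- condition. In the other case the linear part is injective on the radical, so independence
  -- modulo `v` suffices.
  · obtain ⟨v, hv, hv0, hLv⟩ := hker
    obtain ⟨y, hy, z, hz, hyz⟩ := hrank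
    refine ⟨v, hv, hv0, by simp [cubic, hLv], y, hy, z, hz, fun a b h => hyz a b ?_⟩
    simpa [hLv] using h
  · push Not at hker
    obtain ⟨y, hy, z, hz, hyz⟩ := exists_pair_mod_span hK 0
    simp only [Submodule.span_zero_singleton, Submodule.mem_bot] at hyz
    obtain ⟨v, hv, hv0, hcv⟩ := M.isCubicForm_cubic.exists_zero (LinearIndependent.pair_iff.mpr hyz)
    have hvK : v ∈ M.pfKernel := by
      refine (Submodule.span_le (p := M.pfKernel)).mpr ?_ hv
      rintro _ (rfl | rfl)
      · exact hy
      · exact hz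
    obtain ⟨y, hy, z, hz, hyz⟩ := exists_pair_mod_span hK v
    refine ⟨v, hvK, hv0, hcv, y, hy, z, hz, fun a b h => hyz a b ?_⟩
    obtain ⟨c, hc⟩ := Submodule.mem_span_singleton.mp h
    refine Submodule.mem_span_singleton.mpr ⟨c, ?_⟩
    by_contra hne
    refine hker (c • v - (a • y + b • z)) (sub_mem (Submodule.smul_mem _ _ hvK)
      (add_mem (Submodule.smul_mem _ _ hy) (Submodule.smul_mem _ _ hz)))
      (sub_ne_zero.mpr hne) ?_
    rw [map_sub, map_add, map_smul, map_smul, map_smul, hc, sub_self]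

end SkGerm

/-! ### Coordinates on the radical and infinitely many classes -/

/-- Linear coordinates on a subspace that start with two given independent linear forms. -/
theorem exists_coordinates {E : Type*} [AddCommGroup E] [Module ℂ E] [FiniteDimensional ℂ E]
    {K : Submodule ℂ E} {r : ℕ} (hK : Module.finrank ℂ K = r + 3) (ℓ : Fin 2 → E →ₗ[ℂ] ℂ)
    {e : Fin 2 → E} (he : ∀ i, e i ∈ K) (hℓ : ∀ i j, ℓ i (e j) = if i = j then 1 else 0) :
    ∃ S : (Fin (r + 3) → ℂ) →ₗ[ℂ] E, Function.Injective S ∧ LinearMap.range S = K ∧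
      ∀ i x, ℓ i (S x) = x (Fin.castLE (by omega) i) := by
  let Λ : K →ₗ[ℂ] Fin 2 → ℂ := (LinearMap.pi ℓ).comp K.subtype
  have hΛ : Function.Surjective Λ := by
    intro c
    refine ⟨c 0 • ⟨e 0, he 0⟩ + c 1 • ⟨e 1, he 1⟩, ?_⟩
    ext i
    fin_cases i <;> simp [Λ, hℓ]
  have hJ : Module.finrank ℂ (LinearMap.ker Λ) = Module.finrank ℂ (Fin (r + 1) → ℂ) := by
    have h := Λ.finrank_range_add_finrank_ker
    rw [LinearMap.range_eq_top.mpr hΛ, finrank_top, hK, Module.finrank_fin_fun] at h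
    rw [Module.finrank_fin_fun]
    omega
  let eJ : LinearMap.ker Λ ≃ₗ[ℂ] (Fin (r + 1) → ℂ) := LinearEquiv.ofFinrankEq _ _ hJ
  have h10 : (Fin.castLE (by omega) (1 : Fin 2) : Fin (r + 3)) = 1 := Fin.ext (by simp)
  let τ : (Fin (r + 3) → ℂ) →ₗ[ℂ] E := K.subtype ∘ₗ (LinearMap.ker Λ).subtype ∘ₗ
    eJ.symm.toLinearMap ∘ₗ LinearMap.funLeft ℂ ℂ fun i : Fin (r + 1) => i.succ.succ
  let S : (Fin (r + 3) → ℂ) →ₗ[ℂ] E :=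
    (LinearMap.proj 0).smulRight (e 0) + (LinearMap.proj 1).smulRight (e 1) + τ
  have hS : ∀ x, S x = x 0 • e 0 + x 1 • e 1 + τ x := fun x => rfl
  have hτ : ∀ i x, ℓ i (τ x) = 0 := fun i x =>
    congrFun (LinearMap.mem_ker.mp (eJ.symm fun i => x i.succ.succ).2) i
  have hℓS : ∀ i x, ℓ i (S x) = x (Fin.castLE (by omega) i) := by
    intro i x
    rw [hS, map_add, map_add, hτ, map_smul, map_smul, hℓ, hℓ]
    fin_cases i
    · simp
    · simp [h10]
  have hinj : Function.Injective S := by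
    rw [injective_iff_map_eq_zero]
    intro x hx
    have h0 : x 0 = 0 := by simpa [hx] using (hℓS 0 x).symm
    have h1 : x 1 = 0 := by simpa [hx, h10] using (hℓS 1 x).symm
    rw [hS, h0, h1, zero_smul, zero_smul, zero_add, zero_add] at hx
    have h2 : eJ.symm (fun i => x i.succ.succ) = 0 :=
      Subtype.ext (Subtype.ext hx)
    rw [LinearEquiv.map_eq_zero_iff] at h2
    ext i
    refine Fin.cases h0 (fun i => Fin.cases h1 (fun i => ?_) i) i
    exact congrFun h2 i
  refine ⟨S, hinj, ?_, hℓS⟩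
  refine Submodule.eq_of_le_of_finrank_eq ?_ ?_
  · rintro _ ⟨x, rfl⟩
    rw [hS]
    exact add_mem (add_mem (K.smul_mem _ (he 0)) (K.smul_mem _ (he 1))) (Subtype.coe_prop _)
  · rw [LinearMap.finrank_range_of_inj hinj, hK, Module.finrank_fin_fun]

/-- Linear forms `⟨·, w₀⟩`, `⟨·, w₁⟩` for the polarised Pfaffian dual to a pair of vectors and
vanishing on a third one. -/
theorem exists_dual_pair {u : Fin 2 → Fin 6 → ℂ} {v : Fin 6 → ℂ}
    (h : ∀ a b : ℂ, a • u 0 + b • u 1 ∈ Submodule.span ℂ {v} → a = 0 ∧ b = 0) :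
    ∃ w : Fin 2 → Fin 6 → ℂ, (∀ i j, pfPolar (u j) (w i) = if i = j then 1 else 0) ∧
      ∀ i, pfPolar v (w i) = 0 := by
  have h0 : u 0 ∉ Submodule.span ℂ {u 1, v} := by
    intro hu
    obtain ⟨a, z, hz, hu⟩ := Submodule.mem_span_insert.mp hu
    exact one_ne_zero (h 1 (-a) (by
      rw [show (1 : ℂ) • u 0 + -a • u 1 = z by rw [hu]; module]; exact hz)).1
  have h1 : u 1 ∉ Submodule.span ℂ {u 0, v} := by
    intro hu
    obtain ⟨a, z, hz, hu⟩ := Submodule.mem_span_insert.mp hu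
    exact one_ne_zero (h (-a) 1 (by
      rw [show -a • u 0 + (1 : ℂ) • u 1 = z by rw [hu]; module]; exact hz)).2
  obtain ⟨f, hf1, hf0⟩ := exists_dual_eq_one h0
  obtain ⟨g, hg1, hg0⟩ := exists_dual_eq_one h1
  obtain ⟨w₀, hw₀⟩ := exists_pfPolar_eq f
  obtain ⟨w₁, hw₁⟩ := exists_pfPolar_eq g
  refine ⟨![w₀, w₁], fun i j => ?_, fun i => ?_⟩
  · fin_cases i <;> fin_cases j
    · simpa [hw₀] using hf1
    · simpa [hw₀] using hf0 (u 1) (Submodule.subset_span (by simp))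
    · simpa [hw₁] using hg0 (u 0) (Submodule.subset_span (by simp))
    · simpa [hw₁] using hg1
  · fin_cases i
    · simpa [hw₀] using hf0 v (Submodule.subset_span (by simp))
    · simpa [hw₁] using hg0 v (Submodule.subset_span (by simp))

/-- Coordinates on the radical of a germ turn the cubic part into a cubic form whose class under
linear coordinate changes is an invariant of the jet. -/
theorem JetEquivalent.exists_mulVec {M N : SkGerm s 4} {k m : ℕ} (hk : 2 ≤ k)
    (h : JetEquivalent k M N) {S S' : (Fin m → ℂ) →ₗ[ℂ] (Fin s → ℂ)}
    (hS : Function.Injective S) (hSr : LinearMap.range S = M.pfKernel)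
    (hS' : Module.finrank ℂ N.pfKernel = m →
      Function.Injective S' ∧ LinearMap.range S' = N.pfKernel) :
    ∃ G : Fin m → Fin m → ℂ, ∀ x, M.cubic (S x) = N.cubic (S' (Matrix.mulVec G x)) := by
  obtain ⟨g, d, -, hker, hcub⟩ := h.exists_linearEquiv hk
  have hmap : M.pfKernel.map g.toLinearMap = N.pfKernel := by
    ext y
    rw [Submodule.mem_map]
    constructor
    · rintro ⟨x, hx, rfl⟩
      exact (hker x).mp hx
    · intro hy
      exact ⟨g.symm y, (hker _).mpr (by simpa using hy), by simp⟩
  have hfin : Module.finrank ℂ N.pfKernel = m := by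
    rw [← hmap, ← hSr, LinearEquiv.finrank_map_eq, LinearMap.finrank_range_of_inj hS,
      Module.finrank_fin_fun]
  obtain ⟨hS'i, hS'r⟩ := hS' hfin
  obtain ⟨R, hR⟩ := S'.exists_leftInverse_of_injective (LinearMap.ker_eq_bot.mpr hS'i)
  -- A cubic form satisfies `C (δ z) = δ³ C z`, so a cube root of `d` absorbs the scalar into the
  -- linear map.
  obtain ⟨δ, hδ⟩ := IsAlgClosed.exists_pow_nat_eq d (n := 3) (by norm_num)
  refine ⟨LinearMap.toMatrix' (δ • (R ∘ₗ g.toLinearMap ∘ₗ S)), fun x => ?_⟩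
  have hx : S x ∈ M.pfKernel := hSr ▸ LinearMap.mem_range_self S x
  obtain ⟨z, hz⟩ : g (S x) ∈ LinearMap.range S' := hS'r ▸ (hker _).mp hx
  have hRz : R (g (S x)) = z := by
    rw [← hz]
    exact congrArg (fun f : (Fin m → ℂ) →ₗ[ℂ] (Fin m → ℂ) => f z) hR
  have hmv : Matrix.mulVec (LinearMap.toMatrix' (δ • (R ∘ₗ g.toLinearMap ∘ₗ S))) x = δ • z := by
    rw [LinearMap.toMatrix'_mulVec, LinearMap.smul_apply, ← hRz]
    rfl
  exact (hcub _ hx).trans (by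
    rw [hmv, map_smul, N.isCubicForm_cubic.map_smul, hδ, hz])

/-- A germ whose Pfaffian has a quadratic part with radical of dimension at least three, on which
the linear part has rank at least two, is not simple. -/
theorem not_finite_jet_classes (M : SkGerm s 4) (hK : 3 ≤ Module.finrank ℂ M.pfKernel)
    (hrank : ∃ k₁ ∈ M.pfKernel, ∃ k₂ ∈ M.pfKernel, ∀ a b : ℂ,
        a • M.lin k₁ + b • M.lin k₂ = 0 → a = 0 ∧ b = 0)
    {k : ℕ} (hk : 2 ≤ k) {U : Set (JetSpace s 4 k)} (hU : U ∈ 𝓝 (M.jet k))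
    {F : Set (SkGerm s 4)} (hF : F.Finite)
    (hcover : ∀ M' : SkGerm s 4, M'.jet k ∈ U → ∃ N ∈ F, JetEquivalent k M' N) : False := by
  obtain ⟨r, hr⟩ : ∃ r, Module.finrank ℂ M.pfKernel = r + 3 := ⟨_, (Nat.sub_add_cancel hK).symm⟩
  obtain ⟨v, hv, hv0, hcv, y, hy, z, hz, hyz⟩ := M.exists_cubic_zero hK hrank
  obtain ⟨w, hw, hwv⟩ := exists_dual_pair (u := ![M.lin y, M.lin z]) hyz
  let ℓ : Fin 2 → (Fin s → ℂ) →ₗ[ℂ] ℂ := fun i => (pfPolar.flip (w i)).comp M.lin.toLinearMap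
  have hℓ : ∀ i x, ℓ i x = pfPolar (M.lin x) (w i) := fun i x => rfl
  obtain ⟨S, hSi, hSr, hℓS⟩ := exists_coordinates hr ℓ (e := ![y, z])
    (by intro i; fin_cases i <;> assumption)
    (by
      intro i j
      rw [← hw, hℓ]
      fin_cases j <;> rfl)
  obtain ⟨Y, hY⟩ := S.exists_leftInverse_of_injective (LinearMap.ker_eq_bot.mpr hSi)
  have hYS : ∀ x, Y (S x) = x := fun x =>
    congrArg (fun f : (Fin (r + 3) → ℂ) →ₗ[ℂ] (Fin (r + 3) → ℂ) => f x) hY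
  obtain ⟨v', rfl⟩ : v ∈ LinearMap.range S := hSr ▸ hv
  -- Adding `x_i x_b w_a` to the quadratic part adds `⟨L x, w_a⟩ x_i x_b = x_a x_i x_b` to the cubic
  -- and leaves the linear part, hence the radical, unchanged.
  let D : Fin (r + 3) × Fin (r + 3) → SkGerm s 4 := fun ij =>
    SkGerm.ofProduct (LinearMap.proj ij.1 ∘ₗ Y) (LinearMap.proj (rightIndex ij.1 ij.2) ∘ₗ Y)
      (w (leftIndex ij.1 ij.2))
  let P : (Fin (r + 3) → Fin (r + 3) → ℂ) → SkGerm s 4 := fun p =>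
    M.perturb D fun ij => p ij.1 ij.2
  have hlin : ∀ p x, (P p).lin x = M.lin x := by
    intro p x
    rw [(SkGerm.lin_quad_perturb M D _ x).1]
    simp [D, (SkGerm.lin_quad_ofProduct _ _ _ _).1]
  have hker : ∀ p, (P p).pfKernel = M.pfKernel := by
    intro p
    ext x
    simp only [SkGerm.mem_pfKernel, hlin]
  let Φ : (Fin (r + 3) → Fin (r + 3) → ℂ) →ₗ[ℂ] (Fin (r + 3) → ℂ) → ℂ :=
    { toFun := fun p x => ∑ i, ∑ j, p i j *
        (x (Fin.castLE (by omega) (leftIndex i j)) * x i * x (rightIndex i j))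
      map_add' := fun p q => by
        ext x
        simp only [Pi.add_apply, add_mul, Finset.sum_add_distrib]
      map_smul' := fun c p => by
        ext x
        simp only [Pi.smul_apply, smul_eq_mul, mul_assoc, Finset.mul_sum, RingHom.id_apply] }
  have hcub : ∀ p x, (P p).cubic (S x) = M.cubic (S x) + Φ p x := by
    intro p x
    rw [SkGerm.cubic, SkGerm.cubic, hlin, (SkGerm.lin_quad_perturb M D _ (S x)).2, map_add,
      map_sum, Fintype.sum_prod_type]
    congr 1
    refine Finset.sum_congr rfl fun i _ => Finset.sum_congr rfl fun j _ => ?_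
    rw [map_smul, (SkGerm.lin_quad_ofProduct _ _ _ _).2, map_smul, ← hℓ, hℓS]
    simp only [LinearMap.comp_apply, hYS, LinearMap.proj_apply, smul_eq_mul]
    ring
  have hex : ∀ N : SkGerm s 4, ∃ S' : (Fin (r + 3) → ℂ) →ₗ[ℂ] (Fin s → ℂ),
      Module.finrank ℂ N.pfKernel = r + 3 →
        Function.Injective S' ∧ LinearMap.range S' = N.pfKernel := by
    intro N
    by_cases hN : Module.finrank ℂ N.pfKernel = r + 3
    · let e : (Fin (r + 3) → ℂ) ≃ₗ[ℂ] N.pfKernel :=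
        LinearEquiv.ofFinrankEq _ _ (by rw [hN, Module.finrank_fin_fun])
      refine ⟨N.pfKernel.subtype ∘ₗ e.toLinearMap, fun _ => ⟨?_, ?_⟩⟩
      · exact N.pfKernel.injective_subtype.comp e.injective
      · rw [LinearMap.range_comp, LinearEquiv.range, Submodule.map_top, Submodule.range_subtype]
    · exact ⟨0, fun h => absurd h hN⟩
  choose S' hS' using hex
  -- The first two coordinates of `v` vanish, so every monomial of the family does too.
  have hv'ℓ : ∀ i : Fin 2, v' (Fin.castLE (by omega) i) = 0 := fun i =>
    (hℓS i v').symm.trans (hwv i)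
  refine not_covered_by_finite_cubics hF (C := fun N x => N.cubic (S' N x))
    (fun N => N.isCubicForm_cubic.comp (S' N)) (Φ := Φ)
    (fun (n : Fin (r + 3) → Fin 4) i => ((n i : ℕ) : ℂ)) (fun p hp => ?_)
    (c₀ := fun x => M.cubic (S x)) (v := v') (fun h => hv0 (by rw [h, map_zero])) hcv
    (fun p => ?_) ?_
  · exact eq_zero_of_monomials_eq_zero p hp
  · change ∑ i, ∑ j, p i j * _ = (0 : ℂ)
    refine Finset.sum_eq_zero fun i _ => Finset.sum_eq_zero fun j _ => ?_
    rw [hv'ℓ]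
    ring
  · have hc : Continuous fun (p : Fin (r + 3) → Fin (r + 3) → ℂ)
        (ij : Fin (r + 3) × Fin (r + 3)) => p ij.1 ij.2 := by fun_prop
    filter_upwards [(hc.tendsto 0).eventually (M.eventually_jet_perturb_mem D hU)] with p hp
    obtain ⟨N, hN, hMN⟩ := hcover (P p) hp
    obtain ⟨G, hG⟩ := hMN.exists_mulVec hk hSi (hSr.trans (hker p).symm) (hS' N)
    exact ⟨N, hN, G, fun x => by rw [← hcub, hG]⟩

end SkFamilies

theorem mainTheorem6 (s : ℕ) (hs : 3 ≤ s) (M : SkFamilies.SkGerm s 4)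
    (hM : SkFamilies.IsSkSimple M) :
    0 < SkFamilies.rankPfTwoJet M ∧ (4 ≤ s → 2 ≤ SkFamilies.rankPfTwoJet M) := by
  by_contra hcon
  have hrk := SkFamilies.rankPfTwoJet_add_finrank_pfKernel M
  have h1 : SkFamilies.rankPfTwoJet M ≤ 1 := by omega
  have hK : 3 ≤ Module.finrank ℂ M.pfKernel := by omega
  obtain ⟨k, hk, U, hU, F, hF, hcover⟩ := ((eventually_ge_atTop 2).and hM).exists
  -- Perturbing within the interior of `U` keeps `U` a neighbourhood of the new jet, so the same
  -- finite list can be used for `M'`.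
  obtain ⟨M', hM', hK', hrank⟩ := M.exists_perturb_two_le_rank hK h1 (interior_mem_nhds.mpr hU)
  exact SkFamilies.not_finite_jet_classes M' hK' hrank hk
    (mem_interior_iff_mem_nhds.mp hM') hF hcover
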